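/- An \emph{ordered group} is a pair $(G,G^+)$ with $G$ a countable abelian group and $G^+\subseteq G$ such that $G^++G^+\subseteq G^+$, $G^+\cap(-G^+)=\{0\}$ and $G^+-G^+=G$; write $a\le b$ if $b-a\in G^+$. It is a \emph{simple dimension group} if there are integers $d_i\ge 1$ and integer matrices $A_i$ of size $d_{i+1}\times d_i$ $(i\ge 0)$, all of whose entries are strictly positive, and a group isomorphism from $G$ onto the inductive limit of $\mathbb Z^{d_0}\xrightarrow{A_0}\mathbb Z^{d_1}\xrightarrow{A_1}\mathbb Z^{d_2}\xrightarrow{A_2}\cdots$ that maps $G^+$ onto the set of classes of vectors with non-negative entries. An \emph{order unit} is an element $u\in G^+$ such that for every $a\in G$ there is an integer $k\ge 0$ with $a\le ku$. A \emph{subshift} $(Y,S)$ is a closed shift-invariant set $Y\subseteq\mathcal A^{\mathbb Z}$, with $\mathcal A$ a finite non-empty alphabet, together with the shift $(Sy)_i=y_{i+1}$; it is \emph{minimal} if $Y\neq\emptyset$ and the only closed $S$-invariant subsets of $Y$ are $\emptyset$ and $Y$ (a finite orbit is allowed). Its complexity $p_Y(n)$ is the number of words of length $n$ occurring in elements of $Y$.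 Put $H(Y,S)=C(Y,\mathbb Z)/\{f\circ S-f: f\in C(Y,\mathbb Z)\}$, let $H^+(Y,S)$ be the set of classes of non-negative functions, and let $K^0(Y,S)=(H(Y,S),H^+(Y,S),[1])$. \textbf{Theorem.} Let $(G,G^+)$ be a simple dimension group with an order unit $u$, and let $(p_n)_{n\in\mathbb N}$ be a sequence of positive real numbers with $\lim_{n\to\infty} n/p_n=0$. Then there exists a minimal subshift $(Y,S)$ such that \begin{enumerate} \item $K^0(Y,S)$ and $(G,G^+,u)$ are isomorphic as ordered groups with unit, i.e. there is a group isomorphism $\varphi\colon H(Y,S)\to G$ with $\varphi(H^+(Y,S))=G^+$ and $\varphi([1])=u$; \item $\lim_{n\to\infty} p_Y(n)/p_n=0$. \end{enumerate} -/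

import Mathlib

open Filter Topology SymbolicDynamics.FullShift

noncomputable section

namespace DimGroup

/-! ### Ordered groups with unit -/

/-- `(G, Gp)` is an ordered group: `G` is a countable abelian group and `Gp` is a positive cone,
i.e. `Gp + Gp ⊆ Gp`, `Gp ∩ (-Gp) = {0}` and `Gp - Gp = G`. -/
structure IsOrderedGroup {G : Type*} [AddCommGroup G] (Gp : Set G) : Prop where
  countable : Countable G
  add_mem : ∀ a ∈ Gp, ∀ b ∈ Gp, a + b ∈ Gp
  mem_and_neg_mem : ∀ a, (a ∈ Gp ∧ -a ∈ Gp) ↔ a = 0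
  exists_sub : ∀ g, ∃ a ∈ Gp, ∃ b ∈ Gp, g = a - b

/-- `u` is an order unit: `u ∈ Gp` and each `a` satisfies `a ≤ k u` for some natural number `k`. -/
def IsOrderUnit {G : Type*} [AddCommGroup G] (Gp : Set G) (u : G) : Prop :=
  u ∈ Gp ∧ ∀ a : G, ∃ k : ℕ, k • u - a ∈ Gp

/-- Isomorphism of ordered groups. -/
def OrderedIso {G H : Type*} [AddCommGroup G] [AddCommGroup H] (Gp : Set G) (Hp : Set H) : Prop :=
  ∃ φ : G ≃+ H, φ '' Gp = Hp

/-- Isomorphism of ordered groups with unit. -/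
def OrderedUnitIso {G H : Type*} [AddCommGroup G] [AddCommGroup H]
    (Gp : Set G) (u : G) (Hp : Set H) (v : H) : Prop :=
  ∃ φ : G ≃+ H, φ '' Gp = Hp ∧ φ u = v

/-! ### Inductive limits of integer matrices -/

section Limit

variable (d : ℕ → ℕ) (A : ∀ i, Matrix (Fin (d (i + 1))) (Fin (d i)) ℤ)

/-- The composite `A (j-1) ∘ ⋯ ∘ A i : ℤ ^ d i → ℤ ^ d j`, for `i ≤ j`. -/
def transition (i j : ℕ) (h : i ≤ j) : (Fin (d i) → ℤ) →+ (Fin (d j) → ℤ) :=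
  Nat.leRecOn (C := fun k => (Fin (d i) → ℤ) →+ (Fin (d k) → ℤ)) h
    (fun {k} f => (A k).mulVecLin.toAddMonoidHom.comp f) (AddMonoidHom.id _)

theorem transition_self (i : ℕ) (x : Fin (d i) → ℤ) : transition d A i i le_rfl x = x := by
  simp [transition, Nat.leRecOn_self]

theorem transition_succ (i j : ℕ) (h : i ≤ j) (x : Fin (d i) → ℤ) :
    transition d A i (j + 1) (h.trans j.le_succ) x = (A j).mulVec (transition d A i j h x) := by
  simp [transition, Nat.leRecOn_succ h]

instance transition_directedSystem :
    DirectedSystem (fun i => Fin (d i) → ℤ) (fun i j h => transition d A i j h) where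
  map_self i x := transition_self d A i x
  map_map k j i hij hjk x := by
    induction hjk with
    | refl => exact transition_self d A j _
    | step hjk ih =>
      have h1 := transition_succ d A j _ hjk (transition d A i j hij x)
      have h2 := transition_succ d A i _ (hij.trans hjk) x
      exact h1.trans ((congrArg _ ih).trans h2.symm)

/-- The inductive limit `ℤ ^ d 0 → ℤ ^ d 1 → ℤ ^ d 2 → ⋯` along the matrices `A i`. -/
abbrev LimitGroup : Type :=
  DirectLimit (fun i => Fin (d i) → ℤ) (fun i j h => transition d A i j h)

/-- The class `[x, i]` of `x ∈ ℤ ^ d i` in the inductive limit. -/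
def LimitGroup.mk (i : ℕ) (x : Fin (d i) → ℤ) : LimitGroup d A := ⟦⟨i, x⟩⟧

/-- The induced order: the positive cone consists of the classes of non-negative vectors. -/
def LimitGroup.pos : Set (LimitGroup d A) :=
  {g | ∃ (i : ℕ) (x : Fin (d i) → ℤ), (∀ j, 0 ≤ x j) ∧ LimitGroup.mk d A i x = g}

end Limit

/-- `(G, Gp)` is a dimension group: an ordered group isomorphic to an inductive limit of groups
`ℤ ^ d i`, `d i ≥ 1`, along matrices with non-negative entries. -/
def IsDimensionGroup {G : Type*} [AddCommGroup G] (Gp : Set G) : Prop :=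
  IsOrderedGroup Gp ∧
    ∃ (d : ℕ → ℕ) (A : ∀ i, Matrix (Fin (d (i + 1))) (Fin (d i)) ℤ),
      (∀ i, 1 ≤ d i) ∧ (∀ i j k, 0 ≤ A i j k) ∧ OrderedIso Gp (LimitGroup.pos d A)

/-- A dimension group is simple if the matrices can be chosen with all entries (strictly)
positive. -/
def IsSimpleDimensionGroup {G : Type*} [AddCommGroup G] (Gp : Set G) : Prop :=
  IsDimensionGroup Gp ∧
    ∃ (d : ℕ → ℕ) (A : ∀ i, Matrix (Fin (d (i + 1))) (Fin (d i)) ℤ),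
      (∀ i, 1 ≤ d i) ∧ (∀ i j k, 0 < A i j k) ∧ OrderedIso Gp (LimitGroup.pos d A)

/-! ### Minimal systems and their dimension groups -/

section Dynamics

variable {X : Type*} [TopologicalSpace X] (T : X ≃ₜ X)

/-- `(X, T)` is minimal: `X` is non-empty and has no closed `T`-invariant subset but `∅` and `X`. -/
def IsMinimalSystem : Prop :=
  Nonempty X ∧ ∀ C : Set X, IsClosed C → Set.MapsTo T C C → C = ∅ ∨ C = Set.univ

/-- The coboundary map `f ↦ f ∘ T - f` on `C(X, ℤ)`. -/
def coboundary : C(X, ℤ) →+ C(X, ℤ) where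
  toFun f := f.comp (T : C(X, X)) - f
  map_zero' := by ext x; simp
  map_add' f g := by ext x; simp; ring

/-- The group `H(X, T) = C(X, ℤ) / β C(X, ℤ)`. -/
abbrev K0 : Type _ := C(X, ℤ) ⧸ (coboundary T).range

/-- The classes of the non-negative functions. -/
def K0.pos : Set (K0 T) :=
  {g | ∃ f : C(X, ℤ), (∀ x, 0 ≤ f x) ∧ (QuotientAddGroup.mk f : K0 T) = g}

/-- The class of the constant function `1`. -/
def K0.unit : K0 T := QuotientAddGroup.mk (1 : C(X, ℤ))

end Dynamics

/-! ### Subshifts and complexity -/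

section Subshifts

variable {𝒜 : Type*} [TopologicalSpace 𝒜] (Y : Subshift 𝒜 ℤ)

/-- The shift `(S y) i = y (i + 1)`, as a homeomorphism of the subshift `Y`. -/
def shiftMap : Y.carrier ≃ₜ Y.carrier where
  toFun y := ⟨shift 1 y.1, Y.mapsTo 1 y.2⟩
  invFun y := ⟨shift (-1) y.1, Y.mapsTo (-1) y.2⟩
  left_inv y := by ext i; simp
  right_inv y := by ext i; simp
  continuous_toFun := by fun_prop
  continuous_invFun := by fun_prop

/-- The words of length `n` that occur in some element of `Y`. -/
def language (n : ℕ) : Set (Fin n → 𝒜) :=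
  {w | ∃ y ∈ Y.carrier, ∃ i : ℤ, ∀ k : Fin n, w k = y (i + (k : ℕ))}

/-- The complexity `p_Y(n)`: the number of words of length `n` in the language of `Y`. -/
def complexity (n : ℕ) : ℕ := (language Y n).ncard

end Subshifts

end DimGroup

end

/-! ### Nested towers -/

/-- Combinatorial data of a nested sequence of towers: at level `n` there are `d n` towers, of
heights `h n a`, and tower `b` of level `n + 1` is obtained by stacking, for `a = 0, 1, …` in this
order, `A n b a` copies of tower `a` of level `n`. -/
structure TowerData where
  d : ℕ → ℕ
  A : ℕ → ℕ → ℕ → ℕ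
  h : ℕ → ℕ → ℕ
  d_pos : ∀ n, 0 < d n
  A_pos : ∀ n b a, 0 < A n b a
  h_zero_pos : ∀ a, 0 < h 0 a
  h_succ : ∀ n b, h (n + 1) b = ∑ a ∈ Finset.range (d n), A n b a * h n a

namespace TowerData

variable (B : TowerData)

theorem h_pos : ∀ n a, 0 < B.h n a
  | 0, a => B.h_zero_pos a
  | n + 1, b => by
    rw [B.h_succ]
    exact Finset.sum_pos (fun a _ => Nat.mul_pos (B.A_pos n b a) (h_pos n a))
      ⟨0, Finset.mem_range.2 (B.d_pos n)⟩

/-- The height at which the copies of tower `a` start inside tower `b` of level `n + 1`. -/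
def pos (n b a : ℕ) : ℕ := ∑ i ∈ Finset.range a, B.A n b i * B.h n i

/-- The tower of level `n` to which the `j`-th floor of tower `b` of level `n + 1` belongs. -/
def letter (n b j : ℕ) : ℕ := Nat.findGreatest (fun a => B.pos n b a ≤ j) (B.d n - 1)

/-- The address at level `n` of a floor of level `n + 1`. An address is a pair (tower, floor). -/
def loc (n : ℕ) (v : ℕ × ℕ) : ℕ × ℕ :=
  (B.letter n v.1 v.2, (v.2 - B.pos n v.1 (B.letter n v.1 v.2)) % B.h n (B.letter n v.1 v.2))

/-- `v` is the address of a floor of level `n`. -/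
def Valid (n : ℕ) (v : ℕ × ℕ) : Prop := v.1 < B.d n ∧ v.2 < B.h n v.1

/-- The floor `w` may follow the floor `v`: it is the next floor of the same tower, if there is
one, and a bottom floor otherwise. -/
def Step (n : ℕ) (v w : ℕ × ℕ) : Prop :=
  (v.2 + 1 < B.h n v.1 → w = (v.1, v.2 + 1)) ∧ (v.2 + 1 = B.h n v.1 → w.2 = 0)

variable {B}

theorem pos_zero (n b : ℕ) : B.pos n b 0 = 0 := by simp [pos]

theorem pos_succ (n b a : ℕ) : B.pos n b (a + 1) = B.pos n b a + B.A n b a * B.h n a := by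
  simp [pos, Finset.sum_range_succ]

theorem pos_d (n b : ℕ) : B.pos n b (B.d n) = B.h (n + 1) b := by
  rw [B.h_succ, pos]

theorem pos_strictMono (n b : ℕ) : StrictMono (B.pos n b) :=
  strictMono_nat_of_lt_succ fun a => by
    rw [pos_succ]
    exact Nat.lt_add_of_pos_right (Nat.mul_pos (B.A_pos n b a) (B.h_pos n a))

theorem letter_lt (n b j : ℕ) : B.letter n b j < B.d n := by
  have h1 := Nat.findGreatest_le (P := fun a => B.pos n b a ≤ j) (B.d n - 1)
  have h2 := B.d_pos n
  have h3 : B.letter n b j ≤ B.d n - 1 := h1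
  omega

theorem pos_letter_le (n b j : ℕ) : B.pos n b (B.letter n b j) ≤ j :=
  Nat.findGreatest_spec (P := fun a => B.pos n b a ≤ j) (Nat.zero_le _) (by simp [pos_zero])

theorem letter_eq {n b a j : ℕ} (ha : a < B.d n) (h1 : B.pos n b a ≤ j)
    (h2 : j < B.pos n b (a + 1)) : B.letter n b j = a := by
  apply le_antisymm
  · by_contra! hlt
    have := (pos_strictMono (B := B) n b).monotone (Nat.succ_le_of_lt hlt)
    have := pos_letter_le (B := B) n b j
    simp only [Nat.succ_eq_add_one] at *
    omega
  · exact Nat.le_findGreatest (by omega) h1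

theorem letter_mono (n b : ℕ) : Monotone (B.letter n b) := fun _ _ hj =>
  Nat.findGreatest_mono (fun _ h => le_trans h hj) le_rfl

theorem exists_pos_add {n b j : ℕ} (hj : j < B.h (n + 1) b) :
    ∃ a < B.d n, ∃ s < B.A n b a * B.h n a, j = B.pos n b a + s := by
  refine ⟨B.letter n b j, letter_lt n b j, j - B.pos n b (B.letter n b j), ?_, ?_⟩
  · have h1 := pos_letter_le (B := B) n b j
    have h2 : j < B.pos n b (B.letter n b j + 1) := by
      by_contra! hle
      rcases Nat.lt_or_ge (B.letter n b j + 1) (B.d n) with hlt | hge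
      · have : B.letter n b j + 1 ≤ B.letter n b j := Nat.le_findGreatest (by omega) hle
        omega
      · have := (pos_strictMono (B := B) n b).monotone hge
        rw [pos_d] at this
        omega
    rw [pos_succ] at h2
    omega
  · have h1 := pos_letter_le (B := B) n b j
    omega

theorem letter_pos_add {n b a s : ℕ} (ha : a < B.d n) (hs : s < B.A n b a * B.h n a) :
    B.letter n b (B.pos n b a + s) = a :=
  letter_eq ha (Nat.le_add_right _ _) (by rw [pos_succ]; omega)

theorem loc_pos_add {n b a s : ℕ} (ha : a < B.d n) (hs : s < B.A n b a * B.h n a) :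
    B.loc n (b, B.pos n b a + s) = (a, s % B.h n a) := by
  simp [loc, letter_pos_add ha hs]

theorem loc_zero (n b : ℕ) : B.loc n (b, 0) = (0, 0) := by
  have := loc_pos_add (B := B) (b := b) (s := 0) (B.d_pos n)
    (Nat.mul_pos (B.A_pos n b 0) (B.h_pos n 0))
  simpa [pos_zero] using this

theorem mul_sub_one_mod {k m : ℕ} (hk : 0 < k) (hm : 0 < m) : (k * m - 1) % m = m - 1 := by
  obtain ⟨k, rfl⟩ := Nat.exists_eq_succ_of_ne_zero hk.ne'
  have : (k + 1) * m - 1 = (m - 1) + k * m := by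
    rw [add_mul, one_mul]; omega
  rw [Nat.succ_eq_add_one, this, Nat.add_mul_mod_self_right, Nat.mod_eq_of_lt (by omega)]

theorem loc_top (n b : ℕ) :
    B.loc n (b, B.h (n + 1) b - 1) = (B.d n - 1, B.h n (B.d n - 1) - 1) := by
  have hd := B.d_pos n
  have hp := Nat.mul_pos (B.A_pos n b (B.d n - 1)) (B.h_pos n (B.d n - 1))
  have h1 : B.h (n + 1) b - 1 =
      B.pos n b (B.d n - 1) + (B.A n b (B.d n - 1) * B.h n (B.d n - 1) - 1) := by
    have := pos_succ (B := B) n b (B.d n - 1)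
    rw [Nat.sub_add_cancel hd, pos_d] at this
    omega
  rw [h1, loc_pos_add (by omega) (by omega),
    mul_sub_one_mod (B.A_pos n b _) (B.h_pos n _)]

theorem valid_loc (n : ℕ) (v : ℕ × ℕ) : B.Valid n (B.loc n v) :=
  ⟨letter_lt _ _ _, Nat.mod_lt _ (B.h_pos _ _)⟩

/-- Consecutive floors of a tower of level `n + 1`, seen from level `n`. -/
theorem loc_succ {n b j : ℕ} (hj : j + 1 < B.h (n + 1) b) :
    (B.letter n b (j + 1) = B.letter n b j ∧ B.Step n (B.loc n (b, j)) (B.loc n (b, j + 1))) ∨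
    (B.letter n b (j + 1) = B.letter n b j + 1 ∧
      (B.loc n (b, j)).2 + 1 = B.h n (B.letter n b j) ∧
      j + 1 = B.pos n b (B.letter n b (j + 1)) ∧ (B.loc n (b, j + 1)).2 = 0) := by
  obtain ⟨a, ha, s, hs, rfl⟩ := exists_pos_add (Nat.lt_of_succ_lt hj)
  have hh := B.h_pos n a
  rcases Nat.lt_or_ge (s + 1) (B.A n b a * B.h n a) with hlt | hge
  · left
    rw [add_assoc, letter_pos_add ha hs, letter_pos_add ha hlt, loc_pos_add ha hs,
      loc_pos_add ha hlt]
    refine ⟨rfl, fun h1 => ?_, fun h1 => ?_⟩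
    · simp only at h1 ⊢
      rw [← Nat.mod_add_mod, Nat.mod_eq_of_lt h1]
    · simp only at h1 ⊢
      rw [← Nat.mod_add_mod, h1, Nat.mod_self]
  · right
    have hs' : s + 1 = B.A n b a * B.h n a := by omega
    have hp : B.pos n b a + s + 1 = B.pos n b (a + 1) := by rw [pos_succ]; omega
    have ha' : a + 1 < B.d n := by
      by_contra! hc
      have : B.d n = a + 1 := by omega
      rw [← pos_d, this] at hj
      omega
    have hp0 := Nat.mul_pos (B.A_pos n b (a + 1)) (B.h_pos n (a + 1))
    have e1 := letter_pos_add (b := b) ha' hp0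
    have e2 := loc_pos_add (b := b) ha' hp0
    rw [add_zero] at e1 e2
    rw [hp, e1, e2, letter_pos_add ha hs, loc_pos_add ha hs]
    refine ⟨rfl, ?_, rfl, by simp⟩
    have := mul_sub_one_mod (B.A_pos n b a) (B.h_pos n a)
    rw [← hs'] at this
    simp only [Nat.add_sub_cancel] at this
    simp only [this]
    omega

theorem step_loc {n b j : ℕ} (hj : j + 1 < B.h (n + 1) b) :
    B.Step n (B.loc n (b, j)) (B.loc n (b, j + 1)) := by
  rcases loc_succ hj with ⟨-, h⟩ | ⟨-, h1, -, h2⟩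
  · exact h
  · refine ⟨fun h => ?_, fun _ => h2⟩
    change _ < B.h n (B.letter n b j) at h
    omega

theorem sum_range_mul_mod {M : Type*} [AddCommMonoid M] (F : ℕ → M) (k m : ℕ) :
    ∑ s ∈ Finset.range (k * m), F (s % m) = k • ∑ r ∈ Finset.range m, F r := by
  induction k with
  | zero => simp
  | succ k ih =>
    rw [add_mul, one_mul, Finset.sum_range_add, ih, succ_nsmul]
    congr 1
    refine Finset.sum_congr rfl fun r hr => ?_
    rw [Nat.mul_add_mod', Nat.mod_eq_of_lt (Finset.mem_range.1 hr)]

/-- A sum over a tower of level `n + 1`, computed from the towers of level `n`. -/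
theorem sum_loc {M : Type*} [AddCommMonoid M] (F : ℕ × ℕ → M) (n b : ℕ) :
    ∑ j ∈ Finset.range (B.h (n + 1) b), F (B.loc n (b, j)) =
      ∑ a ∈ Finset.range (B.d n), B.A n b a • ∑ r ∈ Finset.range (B.h n a), F (a, r) := by
  have key : ∀ a ≤ B.d n, ∑ j ∈ Finset.range (B.pos n b a), F (B.loc n (b, j)) =
      ∑ i ∈ Finset.range a, B.A n b i • ∑ r ∈ Finset.range (B.h n i), F (i, r) := by
    intro a
    induction a with
    | zero => simp [pos_zero]
    | succ a ih =>
      intro ha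
      rw [pos_succ, Finset.sum_range_add, ih (by omega), Finset.sum_range_succ,
        ← sum_range_mul_mod (fun r => F (a, r))]
      congr 1
      exact Finset.sum_congr rfl fun s hs => by
        rw [loc_pos_add (by omega) (Finset.mem_range.1 hs)]
  rw [← pos_d]
  exact key _ le_rfl

theorem sum_loc_base (n b a : ℕ) (ha : a < B.d n) :
    ∑ j ∈ Finset.range (B.h (n + 1) b), (if B.loc n (b, j) = (a, 0) then (1 : ℤ) else 0) =
      B.A n b a := by
  rw [sum_loc (fun v => if v = (a, 0) then (1 : ℤ) else 0), Finset.sum_eq_single a]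
  · rw [Finset.sum_eq_single 0]
    · simp
    · intro r _ hr; simp [hr]
    · intro h0; exact absurd (Finset.mem_range.2 (B.h_pos n a)) h0
  · intro i _ hi
    simp [hi]
  · intro h0; exact absurd (Finset.mem_range.2 ha) h0

end TowerData

/-! ### Systems with nested tower partitions -/

/-- A homeomorphism `T` whose space is partitioned, at every level `n`, into towers with the
combinatorics of `B`; continuous integer functions are eventually constant on the floors and on
the union of the bottom floors. -/
structure TowerSystem (B : TowerData) {Z : Type*} [TopologicalSpace Z] (T : Z ≃ₜ Z) where
  addr : ℕ → Z → ℕ × ℕ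
  continuous_addr : ∀ n, Continuous (addr n)
  valid : ∀ n z, B.Valid n (addr n z)
  step : ∀ n z, B.Step n (addr n z) (addr n (T z))
  loc_addr : ∀ n z, B.loc n (addr (n + 1) z) = addr n z
  separates : ∀ f : C(Z, ℤ), ∃ N, ∀ n ≥ N, ∀ z z',
    (addr n z = addr n z' ∨ ((addr n z).2 = 0 ∧ (addr n z').2 = 0)) → f z = f z'

namespace TowerSystem

open TowerData

variable {B : TowerData} {Z : Type*} [TopologicalSpace Z] {T : Z ≃ₜ Z} (S : TowerSystem B T)

theorem addr_iterate {n b j : ℕ} {z : Z} (hz : S.addr n z = (b, j)) :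
    ∀ k, j + k < B.h n b → S.addr n (T^[k] z) = (b, j + k)
  | 0, _ => hz
  | k + 1, hk => by
    have ih := addr_iterate hz k (by omega)
    have := (S.step n (T^[k] z)).1 (by rw [ih]; exact hk)
    rw [Function.iterate_succ_apply', this, ih]
    rfl

theorem addr_iterate_height {n b : ℕ} {z : Z} (hz : S.addr n z = (b, 0)) :
    (S.addr n (T^[B.h n b] z)).2 = 0 := by
  have hh := B.h_pos n b
  obtain ⟨m, hm⟩ := Nat.exists_eq_succ_of_ne_zero hh.ne'
  have h1 := S.addr_iterate hz m (by omega)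
  rw [hm, Function.iterate_succ_apply']
  exact (S.step n (T^[m] z)).2 (by rw [h1]; simp only; omega)

theorem exists_iterate_bottom (n : ℕ) (z : Z) : ∃ k, (S.addr n (T^[k] z)).2 = 0 := by
  obtain ⟨-, hv⟩ := S.valid n z
  obtain ⟨b, j, hz⟩ : ∃ b j, S.addr n z = (b, j) := ⟨_, _, rfl⟩
  rw [hz] at hv
  simp only at hv
  have h1 := S.addr_iterate hz (B.h n b - 1 - j) (by omega)
  refine ⟨B.h n b - 1 - j + 1, ?_⟩
  rw [Function.iterate_succ_apply']
  exact (S.step n _).2 (by rw [h1]; simp only; omega)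

theorem exists_iterate_addr {n : ℕ} {v : ℕ × ℕ} (hv : B.Valid n v) (z : Z) :
    ∃ k, S.addr n (T^[k] z) = v := by
  obtain ⟨a, r⟩ := v
  obtain ⟨ha, hr⟩ := hv
  simp only at ha hr
  obtain ⟨k, hk⟩ := S.exists_iterate_bottom (n + 1) z
  set c := (S.addr (n + 1) (T^[k] z)).1 with hc
  have h0 : S.addr (n + 1) (T^[k] z) = (c, 0) := Prod.ext rfl hk
  have hA : r < B.A n c a * B.h n a :=
    lt_of_lt_of_le hr (Nat.le_mul_of_pos_left _ (B.A_pos n c a))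
  have hlt : B.pos n c a + r < B.h (n + 1) c := by
    have := (pos_strictMono (B := B) n c).monotone (Nat.succ_le_of_lt ha)
    rw [Nat.succ_eq_add_one, pos_succ, pos_d] at this
    omega
  have h1 := S.addr_iterate h0 (B.pos n c a + r) (by omega)
  refine ⟨B.pos n c a + r + k, ?_⟩
  rw [Function.iterate_add_apply, ← S.loc_addr, h1, zero_add, loc_pos_add ha hA,
    Nat.mod_eq_of_lt hr]

theorem isMinimalSystem (S : TowerSystem B T) [CompactSpace Z] [T2Space Z]
    [TotallyDisconnectedSpace Z] [Nonempty Z] :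
    DimGroup.IsMinimalSystem T := by
  classical
  refine ⟨inferInstance, fun C hC hT => ?_⟩
  by_contra! hne
  obtain ⟨⟨y, hy⟩, hne⟩ := hne
  obtain ⟨z, hz⟩ := (Set.ne_univ_iff_exists_notMem C).1 hne
  obtain ⟨U, hU, hzU, hUC⟩ := compact_exists_isClopen_in_isOpen hC.isOpen_compl hz
  let f : C(Z, ℤ) := ⟨fun x => if x ∈ U then 1 else 0, by
    refine (IsLocallyConstant.iff_continuous _).1 ?_
    refine IsLocallyConstant.iff_exists_open _ |>.2 fun x => ?_
    by_cases hx : x ∈ U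
    · exact ⟨U, hU.isOpen, hx, fun x' hx' => by simp [hx, hx']⟩
    · exact ⟨Uᶜ, hU.isClosed.isOpen_compl, hx, fun x' hx' => by
        have : x' ∉ U := hx'
        simp [hx, this]⟩⟩
  obtain ⟨N, hN⟩ := S.separates f
  obtain ⟨k, hk⟩ := S.exists_iterate_addr (S.valid N z) y
  have h1 := hN N le_rfl _ _ (Or.inl hk)
  have h2 : T^[k] y ∈ C := by
    have := (hT.iterate k) hy
    exact this
  have h3 : T^[k] y ∉ U := fun h => hUC h h2
  have h4 : z ∈ U := hzU
  change (if T^[k] y ∈ U then (1 : ℤ) else 0) = if z ∈ U then 1 else 0 at h1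
  simp [h3, h4] at h1

/-- The indicator function of a floor. -/
noncomputable def cyl (n : ℕ) (v : ℕ × ℕ) : C(Z, ℤ) :=
  ⟨fun z => if S.addr n z = v then 1 else 0,
    (continuous_of_discreteTopology (f := fun w : ℕ × ℕ => if w = v then (1 : ℤ) else 0)).comp
      (S.continuous_addr n)⟩

theorem cyl_apply (n : ℕ) (v : ℕ × ℕ) (z : Z) :
    S.cyl n v z = if S.addr n z = v then 1 else 0 := rfl

/-- The class in `K0` of the indicator function of a bottom floor. -/
noncomputable def baseClass (n a : ℕ) : DimGroup.K0 T := QuotientAddGroup.mk (S.cyl n (a, 0))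

theorem mk_cyl (n b : ℕ) : ∀ j < B.h n b,
    (QuotientAddGroup.mk (S.cyl n (b, j)) : DimGroup.K0 T) = S.baseClass n b
  | 0, _ => rfl
  | j + 1, hj => by
    rw [← mk_cyl n b j (by omega), eq_comm, ← sub_eq_zero, ← QuotientAddGroup.mk_sub,
      QuotientAddGroup.eq_zero_iff]
    refine ⟨S.cyl n (b, j + 1), ?_⟩
    ext z
    have hs := S.step n z
    obtain ⟨-, hv⟩ := S.valid n z
    have key : S.addr n (T z) = (b, j + 1) ↔ S.addr n z = (b, j) := by
      constructor
      · intro h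
        rcases Nat.lt_or_ge ((S.addr n z).2 + 1) (B.h n (S.addr n z).1) with hlt | hge
        · have := hs.1 hlt
          rw [h, Prod.mk.injEq] at this
          exact Prod.ext this.1.symm (by simp only; omega)
        · have := hs.2 (by omega)
          rw [h] at this
          simp at this
      · intro h
        rw [hs.1 (by rw [h]; exact hj), h]
    simp [DimGroup.coboundary, cyl_apply, key]

theorem mk_eq_sum {n : ℕ} {f : C(Z, ℤ)} {F : ℕ × ℕ → ℤ} (hF : ∀ z, f z = F (S.addr n z)) :
    (QuotientAddGroup.mk f : DimGroup.K0 T) =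
      ∑ b ∈ Finset.range (B.d n), (∑ j ∈ Finset.range (B.h n b), F (b, j)) • S.baseClass n b := by
  have h1 : f = ∑ b ∈ Finset.range (B.d n), ∑ j ∈ Finset.range (B.h n b),
      F (b, j) • S.cyl n (b, j) := by
    ext z
    obtain ⟨hv1, hv2⟩ := S.valid n z
    simp only [ContinuousMap.coe_sum, Finset.sum_apply, ContinuousMap.coe_smul, Pi.smul_apply,
      cyl_apply]
    rw [Finset.sum_eq_single (S.addr n z).1, Finset.sum_eq_single (S.addr n z).2]
    · simp [hF]
    · intro j _ hj
      simp [Prod.ext_iff, hj.symm]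
    · intro h; exact absurd (Finset.mem_range.2 hv2) h
    · intro b _ hb
      exact Finset.sum_eq_zero fun j _ => by simp [Prod.ext_iff, hb.symm]
    · intro h; exact absurd (Finset.mem_range.2 hv1) h
  have h2 : (QuotientAddGroup.mk f : DimGroup.K0 T) =
      QuotientAddGroup.mk' (DimGroup.coboundary T).range f := rfl
  rw [h2, h1, map_sum]
  refine Finset.sum_congr rfl fun b _ => ?_
  refine (map_sum _ _ _).trans ?_
  refine Eq.trans ?_ (Finset.sum_smul (s := Finset.range (B.h n b)) (f := fun j => F (b, j))
    (x := S.baseClass n b)).symm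
  refine Finset.sum_congr rfl fun j hj => ?_
  rw [map_zsmul]
  exact congrArg _ (S.mk_cyl n b j (Finset.mem_range.1 hj))

theorem baseClass_eq_sum {n a : ℕ} (ha : a < B.d n) :
    S.baseClass n a = ∑ b ∈ Finset.range (B.d (n + 1)), B.A n b a • S.baseClass (n + 1) b := by
  rw [baseClass, S.mk_eq_sum (n := n + 1)
    (F := fun v => if B.loc n v = (a, 0) then 1 else 0)
    (fun z => by rw [cyl_apply, S.loc_addr])]
  refine Finset.sum_congr rfl fun b _ => ?_
  rw [sum_loc_base n b a ha, natCast_zsmul]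

theorem unit_eq_sum :
    DimGroup.K0.unit T = ∑ a ∈ Finset.range (B.d 0), B.h 0 a • S.baseClass 0 a := by
  rw [DimGroup.K0.unit, S.mk_eq_sum (n := 0) (F := fun _ => 1) (fun z => rfl)]
  simp

theorem exists_eq_comp_addr (f : C(Z, ℤ)) :
    ∃ n, ∃ F : ℕ × ℕ → ℤ, (∀ z, f z = F (S.addr n z)) ∧ ((∀ z, 0 ≤ f z) → ∀ v, 0 ≤ F v) := by
  classical
  obtain ⟨n, hn⟩ := S.separates f
  refine ⟨n, fun v => if h : ∃ z, S.addr n z = v then f h.choose else 0, fun z => ?_,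
    fun hf v => ?_⟩
  · have h : ∃ z', S.addr n z' = S.addr n z := ⟨z, rfl⟩
    simp only [dif_pos h]
    exact hn n le_rfl _ _ (Or.inl h.choose_spec.symm)
  · dsimp only
    split_ifs with h
    · exact hf _
    · exact le_rfl

end TowerSystem

/-! ### Comparison of two limits -/

section Comparison

variable {B : TowerData}

/-- The vector of level `n + 1` representing the same element as `x`. -/
def TowerData.push (B : TowerData) (n : ℕ) (x : ℕ → ℤ) (b : ℕ) : ℤ :=
  ∑ a ∈ Finset.range (B.d n), (B.A n b a : ℤ) * x a

/-- A family `γ` of elements of an abelian group that satisfies the relations of the towers. -/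
def TowerData.Compatible (B : TowerData) {M : Type*} [AddCommGroup M] (γ : ℕ → ℕ → M) : Prop :=
  ∀ n a, a < B.d n → γ n a = ∑ b ∈ Finset.range (B.d (n + 1)), B.A n b a • γ (n + 1) b

/-- The element represented by the vector `x` at level `n`. -/
def TowerData.eval (B : TowerData) {M : Type*} [AddCommGroup M] (γ : ℕ → ℕ → M) (n : ℕ)
    (x : ℕ → ℤ) : M :=
  ∑ a ∈ Finset.range (B.d n), x a • γ n a

variable {M : Type*} [AddCommGroup M] {γ : ℕ → ℕ → M}

theorem TowerData.Compatible.eval_push (hγ : B.Compatible γ) (n : ℕ) (x : ℕ → ℤ) :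
    B.eval γ (n + 1) (B.push n x) = B.eval γ n x := by
  unfold eval push
  simp_rw [Finset.sum_smul]
  rw [Finset.sum_comm]
  refine Finset.sum_congr rfl fun a ha => ?_
  rw [hγ n a (Finset.mem_range.1 ha), Finset.smul_sum]
  refine Finset.sum_congr rfl fun b _ => ?_
  rw [mul_comm, mul_smul, natCast_zsmul]

theorem TowerData.eval_add (n : ℕ) (x y : ℕ → ℤ) :
    B.eval γ n (x + y) = B.eval γ n x + B.eval γ n y := by
  simp [eval, add_smul, Finset.sum_add_distrib]

theorem TowerData.eval_neg (n : ℕ) (x : ℕ → ℤ) : B.eval γ n (-x) = -B.eval γ n x := by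
  simp [eval]

theorem TowerData.exists_eval_eq {M' : Type*} [AddCommGroup M'] {γ' : ℕ → ℕ → M'}
    (hγ : B.Compatible γ) (hγ' : B.Compatible γ') {n m : ℕ} (hnm : n ≤ m) (x : ℕ → ℤ) :
    ∃ x', B.eval γ m x' = B.eval γ n x ∧ B.eval γ' m x' = B.eval γ' n x := by
  induction m, hnm using Nat.le_induction with
  | base => exact ⟨x, rfl, rfl⟩
  | succ m _ ih =>
    obtain ⟨x', h1, h2⟩ := ih
    exact ⟨B.push m x', by rw [hγ.eval_push, h1], by rw [hγ'.eval_push, h2]⟩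

/-- A subgroup of a product that is the graph of a bijection is the graph of an isomorphism. -/
theorem exists_addEquiv_of_graph {K : Type*} [AddCommGroup K] (R : AddSubgroup (K × M))
    (h1 : ∀ k, ∃ g, (k, g) ∈ R) (h2 : ∀ g, ∃ k, (k, g) ∈ R)
    (h3 : ∀ k, (k, 0) ∈ R → k = 0) (h4 : ∀ g, (0, g) ∈ R → g = 0) :
    ∃ φ : K ≃+ M, ∀ k g, (k, g) ∈ R → φ k = g := by
  choose f hf using h1
  have key : ∀ k g, (k, g) ∈ R → f k = g := fun k g h =>
    sub_eq_zero.1 (h4 _ (by simpa using R.sub_mem (hf k) h))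
  let F : K →+ M := ⟨⟨f, key _ _ (R.zero_mem)⟩, fun a b => key _ _ (R.add_mem (hf a) (hf b))⟩
  have hb : Function.Bijective F := by
    constructor
    · refine (injective_iff_map_eq_zero F).2 fun k hk => h3 k ?_
      have := hf k
      change f k = 0 at hk
      rwa [hk] at this
    · intro g
      obtain ⟨k, hk⟩ := h2 g
      exact ⟨k, key _ _ hk⟩
  exact ⟨AddEquiv.ofBijective F hb, fun k g h => key k g h⟩

end Comparison

namespace TowerSystem

variable {B : TowerData} {Z : Type*} [TopologicalSpace Z] {T : Z ≃ₜ Z} (S : TowerSystem B T)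
  {G : Type*} [AddCommGroup G] {γ : ℕ → ℕ → G}

theorem exists_lift_eval (hγ : B.Compatible γ) {n m : ℕ} (hnm : n ≤ m) (x : ℕ → ℤ) :
    ∃ F : ℕ × ℕ → ℤ,
      (∀ z, (∑ a ∈ Finset.range (B.d n), x a • S.cyl n (a, 0)) z = F (S.addr m z)) ∧
      B.eval γ n x = B.eval γ m fun b => ∑ j ∈ Finset.range (B.h m b), F (b, j) := by
  induction m, hnm using Nat.le_induction with
  | base =>
    refine ⟨fun v => if v.2 = 0 then x v.1 else 0, fun z => ?_, ?_⟩
    · obtain ⟨hv1, -⟩ := S.valid n z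
      simp only [ContinuousMap.coe_sum, Finset.sum_apply, ContinuousMap.coe_smul, Pi.smul_apply,
        cyl_apply]
      rw [Finset.sum_eq_single (S.addr n z).1]
      · simp [Prod.ext_iff]
      · intro b _ hb
        simp [Prod.ext_iff, hb.symm]
      · intro h; exact absurd (Finset.mem_range.2 hv1) h
    · refine Finset.sum_congr rfl fun a _ => ?_
      simp [Finset.sum_ite_eq', B.h_pos n a]
  | succ m _ ih =>
    obtain ⟨F, h1, h2⟩ := ih
    refine ⟨fun v => F (B.loc m v), fun z => by rw [h1, ← S.loc_addr], ?_⟩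
    rw [h2, ← hγ.eval_push]
    refine Finset.sum_congr rfl fun b _ => ?_
    dsimp only
    rw [TowerData.sum_loc]
    simp [TowerData.push]

theorem sum_coboundary_iterate (g : C(Z, ℤ)) (z : Z) (k : ℕ) :
    ∑ j ∈ Finset.range k, DimGroup.coboundary T g (T^[j] z) = g (T^[k] z) - g z := by
  induction k with
  | zero => simp
  | succ k ih =>
    rw [Finset.sum_range_succ, ih, Function.iterate_succ_apply']
    simp [DimGroup.coboundary]

theorem eval_eq_zero [Nonempty Z] (hγ : B.Compatible γ) {n : ℕ} {x : ℕ → ℤ}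
    (hx : B.eval S.baseClass n x = 0) : B.eval γ n x = 0 := by
  have h1 : B.eval S.baseClass n x = QuotientAddGroup.mk' (DimGroup.coboundary T).range
      (∑ a ∈ Finset.range (B.d n), x a • S.cyl n (a, 0)) := by
    rw [map_sum]
    exact Finset.sum_congr rfl fun a _ => by rw [map_zsmul]; rfl
  rw [h1] at hx
  obtain ⟨g, hg⟩ := (QuotientAddGroup.eq_zero_iff _).1 hx
  obtain ⟨N, hN⟩ := S.separates g
  obtain ⟨F, hF1, hF2⟩ := S.exists_lift_eval hγ (le_max_left n N) x
  rw [hF2]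
  refine Finset.sum_eq_zero fun b hb => ?_
  obtain ⟨z₀⟩ := ‹Nonempty Z›
  obtain ⟨k, hk⟩ := S.exists_iterate_addr (v := (b, 0))
    ⟨Finset.mem_range.1 hb, B.h_pos (max n N) b⟩ z₀
  have h2 := sum_coboundary_iterate (T := T) g (T^[k] z₀) (B.h (max n N) b)
  rw [hN _ (le_max_right n N) _ _ (Or.inr ⟨S.addr_iterate_height hk, by rw [hk]⟩), sub_self,
    hg] at h2
  have h3 : ∑ j ∈ Finset.range (B.h (max n N) b), F (b, j) = 0 := by
    rw [← h2]
    refine Finset.sum_congr rfl fun j hj => ?_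
    rw [hF1, S.addr_iterate hk j (by simpa using hj), zero_add]
  simp [h3]

/-- The dimension group of a system with nested towers is the limit of the groups of integer
vectors along the incidence matrices of the towers. -/
theorem orderedUnitIso (S : TowerSystem B T) [Nonempty Z] {Gp : Set G} {u : G}
    (hG : DimGroup.IsOrderedGroup Gp) (hγ : B.Compatible γ) (hpos : ∀ n a, a < B.d n → γ n a ∈ Gp)
    (hker : ∀ n x, B.eval γ n x = 0 → ∀ b < B.d (n + 1), B.push n x b = 0)
    (hex : ∀ g ∈ Gp, ∃ n x, (∀ a, 0 ≤ x a) ∧ B.eval γ n x = g)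
    (hu : u = ∑ a ∈ Finset.range (B.d 0), B.h 0 a • γ 0 a) :
    DimGroup.OrderedUnitIso (DimGroup.K0.pos T) (DimGroup.K0.unit T) Gp u := by
  have hβ : B.Compatible S.baseClass := fun n a ha => S.baseClass_eq_sum ha
  have hGp0 : (0 : G) ∈ Gp := ((hG.mem_and_neg_mem 0).2 rfl).1
  have hnn : ∀ n x, (∀ a, 0 ≤ x a) → B.eval γ n x ∈ Gp := by
    intro n x hx
    have hsm : ∀ (k : ℕ) (g : G), g ∈ Gp → k • g ∈ Gp := by
      intro k g hg
      induction k with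
      | zero => simpa using hGp0
      | succ k ih => rw [succ_nsmul]; exact hG.add_mem _ ih _ hg
    refine Finset.sum_induction _ (· ∈ Gp) (fun a b ha hb => hG.add_mem a ha b hb) hGp0 ?_
    intro a ha
    obtain ⟨k, hk⟩ := Int.eq_ofNat_of_zero_le (hx a)
    rw [hk, natCast_zsmul]
    exact hsm _ _ (hpos n a (Finset.mem_range.1 ha))
  let R : AddSubgroup (DimGroup.K0 T × G) :=
    { carrier := {p | ∃ n x, p = (B.eval S.baseClass n x, B.eval γ n x)}
      zero_mem' := ⟨0, 0, by
        simp only [TowerData.eval, Pi.zero_apply, zero_zsmul, Finset.sum_const_zero]; rfl⟩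
      add_mem' := by
        rintro _ _ ⟨n, x, rfl⟩ ⟨m, y, rfl⟩
        obtain ⟨x', h1, h2⟩ := TowerData.exists_eval_eq hβ hγ (le_max_left n m) x
        obtain ⟨y', h3, h4⟩ := TowerData.exists_eval_eq hβ hγ (le_max_right n m) y
        exact ⟨max n m, x' + y', by
          simp [TowerData.eval_add, h1, h2, h3, h4]⟩
      neg_mem' := by
        rintro _ ⟨n, x, rfl⟩
        exact ⟨n, -x, by simp [TowerData.eval_neg]⟩ }
  have hK : ∀ f : C(Z, ℤ), ∃ n x, B.eval S.baseClass n x = (QuotientAddGroup.mk f : DimGroup.K0 T)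
      ∧ ((∀ z, 0 ≤ f z) → ∀ a, 0 ≤ x a) := by
    intro f
    obtain ⟨n, F, hF, hF0⟩ := S.exists_eq_comp_addr f
    exact ⟨n, fun b => ∑ j ∈ Finset.range (B.h n b), F (b, j), (S.mk_eq_sum hF).symm,
      fun hf a => Finset.sum_nonneg fun j _ => hF0 hf _⟩
  obtain ⟨φ, hφ⟩ := exists_addEquiv_of_graph R
    (by
      intro k
      obtain ⟨f, rfl⟩ := QuotientAddGroup.mk_surjective k
      obtain ⟨n, x, h, -⟩ := hK f
      exact ⟨B.eval γ n x, n, x, by rw [h]⟩)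
    (by
      intro g
      obtain ⟨a, ha, b, hb, rfl⟩ := hG.exists_sub g
      obtain ⟨n, x, -, rfl⟩ := hex a ha
      obtain ⟨m, y, -, rfl⟩ := hex b hb
      refine ⟨B.eval S.baseClass n x - B.eval S.baseClass m y, ?_⟩
      exact R.sub_mem (x := (B.eval S.baseClass n x, B.eval γ n x))
        (y := (B.eval S.baseClass m y, B.eval γ m y)) ⟨n, x, rfl⟩ ⟨m, y, rfl⟩)
    (by
      rintro k ⟨n, x, h⟩
      rw [Prod.mk.injEq] at h
      rw [h.1, ← hβ.eval_push]
      exact Finset.sum_eq_zero fun b hb => by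
        rw [hker n x h.2.symm b (Finset.mem_range.1 hb), zero_zsmul])
    (by
      rintro g ⟨n, x, h⟩
      rw [Prod.mk.injEq] at h
      rw [h.2]
      exact S.eval_eq_zero hγ h.1.symm)
  refine ⟨φ, ?_, ?_⟩
  · ext g
    constructor
    · rintro ⟨k, ⟨f, hf, rfl⟩, rfl⟩
      obtain ⟨n, x, h, hx⟩ := hK f
      rw [hφ _ (B.eval γ n x) ⟨n, x, by rw [h]⟩]
      exact hnn n x (hx hf)
    · intro hg
      obtain ⟨n, x, hx, rfl⟩ := hex g hg
      refine ⟨B.eval S.baseClass n x, ?_, hφ _ _ ⟨n, x, rfl⟩⟩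
      refine ⟨∑ a ∈ Finset.range (B.d n), x a • S.cyl n (a, 0), fun z => ?_, ?_⟩
      · simp only [ContinuousMap.coe_sum, Finset.sum_apply, ContinuousMap.coe_smul, Pi.smul_apply,
          cyl_apply]
        exact Finset.sum_nonneg fun a _ => smul_nonneg (hx a) (by split_ifs <;> simp)
      · change QuotientAddGroup.mk' (DimGroup.coboundary T).range _ = _
        rw [map_sum]
        exact Finset.sum_congr rfl fun a _ => by rw [map_zsmul]; rfl
  · refine hφ _ _ ⟨0, fun a => B.h 0 a, ?_⟩
    rw [S.unit_eq_sum, hu]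
    simp [TowerData.eval]

end TowerSystem

/-! ### The subshift of a sequence of towers -/

namespace TowerData

variable {B : TowerData}

/-- A compatible system of addresses of all integers at all levels. -/
structure IsPoint (B : TowerData) (t : ℕ → ℤ → ℕ × ℕ) : Prop where
  valid : ∀ n i, B.Valid n (t n i)
  step : ∀ n i, B.Step n (t n i) (t n (i + 1))
  loc : ∀ n i, B.loc n (t (n + 1) i) = t n i

namespace IsPoint

variable {t t' : ℕ → ℤ → ℕ × ℕ}

theorem shift (ht : B.IsPoint t) (k : ℤ) : B.IsPoint fun n i => t n (k + i) where
  valid n i := ht.valid n _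
  step n i := by simpa only [add_assoc] using ht.step n (k + i)
  loc n i := ht.loc n _

theorem add (ht : B.IsPoint t) {n b j : ℕ} {i : ℤ} (hi : t n i = (b, j)) (k : ℕ)
    (hk : j + k < B.h n b) : t n (i + k) = (b, j + k) := by
  induction k with
  | zero => simpa using hi
  | succ k ih =>
    have h1 := ih (by omega)
    have := (ht.step n (i + k)).1 (by rw [h1]; exact hk)
    rw [h1, add_assoc] at this
    exact_mod_cast this

theorem bottom_or_succ (ht : B.IsPoint t) (n : ℕ) (i : ℤ) :
    ((t n i).2 = 0 ∧ (t n (i - 1)).2 + 1 = B.h n (t n (i - 1)).1) ∨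
      (t n i = ((t n (i - 1)).1, (t n (i - 1)).2 + 1)) := by
  have hs := ht.step n (i - 1)
  rw [sub_add_cancel] at hs
  obtain ⟨-, hv⟩ := ht.valid n (i - 1)
  rcases Nat.lt_or_ge ((t n (i - 1)).2 + 1) (B.h n (t n (i - 1)).1) with h | h
  · exact Or.inr (hs.1 h)
  · exact Or.inl ⟨hs.2 (by omega), by omega⟩

theorem pred_of_succ (ht : B.IsPoint t) {n b j : ℕ} {i : ℤ} (hi : t n i = (b, j + 1)) :
    t n (i - 1) = (b, j) := by
  rcases ht.bottom_or_succ n i with ⟨h, -⟩ | h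
  · rw [hi] at h; simp at h
  · rw [hi, Prod.mk.injEq] at h
    exact Prod.ext h.1.symm (by simp only; omega)

theorem pred_of_bottom (ht : B.IsPoint t) {n : ℕ} {i : ℤ} (hi : (t n i).2 = 0) :
    (t n (i - 1)).2 + 1 = B.h n (t n (i - 1)).1 := by
  rcases ht.bottom_or_succ n i with ⟨-, h⟩ | h
  · exact h
  · rw [h] at hi; simp at hi

theorem sub (ht : B.IsPoint t) {n b j : ℕ} {i : ℤ} (hi : t n i = (b, j)) (k : ℕ)
    (hk : k ≤ j) : t n (i - k) = (b, j - k) := by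
  induction k with
  | zero => simpa using hi
  | succ k ih =>
    have h1 := ih (by omega)
    have := ht.pred_of_succ (j := j - (k + 1)) (h1.trans (by congr 1; omega))
    rw [sub_sub] at this
    exact_mod_cast this

theorem add_height (ht : B.IsPoint t) {n b j : ℕ} {i : ℤ} (hi : t n i = (b, j)) (k : ℕ)
    (hk : j + k = B.h n b) : (t n (i + k)).2 = 0 := by
  obtain ⟨-, hv⟩ := ht.valid n i
  rw [hi] at hv
  simp only at hv
  obtain ⟨m, rfl⟩ := Nat.exists_eq_succ_of_ne_zero (n := k) (by omega)
  have h1 := ht.add hi m (by omega)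
  have := (ht.step n (i + m)).2 (by rw [h1]; simp only; omega)
  rw [add_assoc] at this
  exact_mod_cast this

theorem add_of_bottom (ht : B.IsPoint t) {n : ℕ} {i : ℤ} (hi : (t (n + 1) i).2 = 0) {e : ℕ}
    (he : e < B.h n 0) : t n (i + e) = (0, e) := by
  have h0 : t n i = (0, 0) := by
    rw [← ht.loc, ← loc_zero n (t (n + 1) i).1]
    congr 1
    exact Prod.ext rfl hi
  simpa using ht.add h0 e (by omega)

theorem pred_letter_of_bottom (ht : B.IsPoint t) {n : ℕ} {i : ℤ} (hi : (t (n + 1) i).2 = 0) :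
    t n (i - 1) = (B.d n - 1, B.h n (B.d n - 1) - 1) := by
  have := ht.pred_of_bottom hi
  rw [← ht.loc, ← loc_top n (t (n + 1) (i - 1)).1]
  congr 1
  exact Prod.ext rfl (by simp only; omega)

theorem sub_of_bottom (ht : B.IsPoint t) {n : ℕ} {i : ℤ} (hi : (t (n + 1) i).2 = 0) {e : ℕ}
    (he : e < B.h n (B.d n - 1)) :
    t n (i - 1 - e) = (B.d n - 1, B.h n (B.d n - 1) - 1 - e) :=
  ht.sub (ht.pred_letter_of_bottom hi) e (by omega)

theorem eq_of_addr (ht : B.IsPoint t) (ht' : B.IsPoint t') {n K : ℕ}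
    (h : t (n + 1) 0 = t' (n + 1) 0 ∨ ((t (n + 1) 0).2 = 0 ∧ (t' (n + 1) 0).2 = 0))
    (hK : K < B.h n 0) (hK' : K < B.h n (B.d n - 1)) :
    ∀ i : ℤ, |i| ≤ K → t n i = t' n i := by
  have fwd : ∀ i : ℕ, i ≤ K → t n (i : ℤ) = t' n (i : ℤ) := by
    intro i hi
    rcases h with h | ⟨h, h'⟩
    · obtain ⟨b, j, hb⟩ : ∃ b j, t (n + 1) 0 = (b, j) := ⟨_, _, rfl⟩
      have hv := (ht.valid (n + 1) 0).2
      rw [hb] at hv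
      simp only at hv
      rcases Nat.lt_or_ge (j + i) (B.h (n + 1) b) with hlt | hge
      · have e1 := ht.add hb i hlt
        have e2 := ht'.add (h ▸ hb) i hlt
        rw [zero_add] at e1 e2
        rw [← ht.loc, ← ht'.loc, e1, e2]
      · have e1 := ht.add_height hb (B.h (n + 1) b - j) (by omega)
        have e2 := ht'.add_height (h ▸ hb) (B.h (n + 1) b - j) (by omega)
        have f1 := ht.add_of_bottom e1 (e := i - (B.h (n + 1) b - j)) (by omega)
        have f2 := ht'.add_of_bottom e2 (e := i - (B.h (n + 1) b - j)) (by omega)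
        have : (0 : ℤ) + ((B.h (n + 1) b - j : ℕ) : ℤ) + ((i - (B.h (n + 1) b - j) : ℕ) : ℤ)
            = i := by omega
        rw [this] at f1 f2
        rw [f1, f2]
    · have f1 := ht.add_of_bottom h (e := i) (by omega)
      have f2 := ht'.add_of_bottom h' (e := i) (by omega)
      rw [zero_add] at f1 f2
      rw [f1, f2]
  have bwd : ∀ i : ℕ, i ≤ K → t n (-(i : ℤ)) = t' n (-(i : ℤ)) := by
    intro i hi
    rcases h with h | ⟨h, h'⟩
    · obtain ⟨b, j, hb⟩ : ∃ b j, t (n + 1) 0 = (b, j) := ⟨_, _, rfl⟩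
      rcases Nat.lt_or_ge j i with hlt | hge
      · have e1 : (t (n + 1) (0 - j)).2 = 0 := by rw [ht.sub hb j le_rfl]; simp
        have e2 : (t' (n + 1) (0 - j)).2 = 0 := by rw [ht'.sub (h ▸ hb) j le_rfl]; simp
        have f1 := ht.sub_of_bottom e1 (e := i - 1 - j) (by omega)
        have f2 := ht'.sub_of_bottom e2 (e := i - 1 - j) (by omega)
        have : (0 : ℤ) - (j : ℤ) - 1 - ((i - 1 - j : ℕ) : ℤ) = -i := by omega
        rw [this] at f1 f2
        rw [f1, f2]
      · have e1 := ht.sub hb i hge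
        have e2 := ht'.sub (h ▸ hb) i hge
        rw [zero_sub] at e1 e2
        rw [← ht.loc, ← ht'.loc, e1, e2]
    · rcases Nat.eq_zero_or_pos i with rfl | hpos
      · simpa using fwd 0 (by omega)
      have f1 := ht.sub_of_bottom h (e := i - 1) (by omega)
      have f2 := ht'.sub_of_bottom h' (e := i - 1) (by omega)
      have : (0 : ℤ) - 1 - ((i - 1 : ℕ) : ℤ) = -i := by omega
      rw [this] at f1 f2
      rw [f1, f2]
  intro i hi
  rw [Int.abs_eq_natAbs] at hi
  rcases Int.natAbs_eq i with h | h
  · rw [h]; exact fwd _ (by omega)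
  · rw [h]; exact bwd _ (by omega)

theorem eq_of_le (ht : B.IsPoint t) (ht' : B.IsPoint t') {n m : ℕ} (hmn : m ≤ n) {i : ℤ}
    (h : t n i = t' n i) : t m i = t' m i := by
  induction n, hmn using Nat.le_induction with
  | base => exact h
  | succ n _ ih => exact ih (by rw [← ht.loc, ← ht'.loc, h])

end IsPoint

variable (B)

/-- The set of compatible systems of addresses. -/
def points : Set (ℕ → ℤ → ℕ × ℕ) := {t | B.IsPoint t}

variable {B}

theorem isClosed_points : IsClosed B.points := by
  have : B.points = (⋂ n, ⋂ i, {t | B.Valid n (t n i)}) ∩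
      (⋂ n, ⋂ i, {t | B.Step n (t n i) (t n (i + 1))}) ∩
      (⋂ n, ⋂ i, {t | B.loc n (t (n + 1) i) = t n i}) := by
    ext t
    simp only [points, Set.mem_ofPred_eq, Set.mem_inter_iff, Set.mem_iInter]
    exact ⟨fun h => ⟨⟨h.1, h.2⟩, h.3⟩, fun h => ⟨h.1.1, h.1.2, h.2⟩⟩
  rw [this]
  refine IsClosed.inter (IsClosed.inter ?_ ?_) ?_ <;>
    refine isClosed_iInter fun n => isClosed_iInter fun i => ?_
  · exact (isClosed_discrete {v | B.Valid n v}).preimage (f := fun t : ℕ → ℤ → ℕ × ℕ => t n i)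
      (by fun_prop)
  · exact (isClosed_discrete {p : (ℕ × ℕ) × (ℕ × ℕ) | B.Step n p.1 p.2}).preimage
      (f := fun t : ℕ → ℤ → ℕ × ℕ => (t n i, t n (i + 1))) (by fun_prop)
  · exact (isClosed_discrete {p : (ℕ × ℕ) × (ℕ × ℕ) | B.loc n p.1 = p.2}).preimage
      (f := fun t : ℕ → ℤ → ℕ × ℕ => (t (n + 1) i, t n i)) (by fun_prop)

theorem finite_valid (n : ℕ) : {v | B.Valid n v}.Finite := by
  refine ((Set.finite_Iio (B.d n)).prod
    (Set.finite_Iio (∑ a ∈ Finset.range (B.d n), B.h n a))).subset ?_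
  rintro ⟨a, r⟩ ⟨ha, hr⟩
  refine ⟨ha, lt_of_lt_of_le hr ?_⟩
  exact Finset.single_le_sum (f := fun a => B.h n a) (fun _ _ => Nat.zero_le _)
    (Finset.mem_range.2 ha)

variable (B) in
/-- The compact set of all systems of valid addresses. -/
def validBox : Set (ℕ → ℤ → ℕ × ℕ) :=
  Set.pi Set.univ fun n => Set.pi Set.univ fun _ => {v | B.Valid n v}

theorem isCompact_validBox : IsCompact B.validBox :=
  isCompact_univ_pi fun n => isCompact_univ_pi fun _ => (finite_valid n).isCompact

theorem isCompact_points : IsCompact B.points :=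
  isCompact_validBox.of_isClosed_subset isClosed_points
    fun _ ht n _ i _ => IsPoint.valid ht n i

theorem continuous_points_apply (n : ℕ) (i : ℤ) : Continuous fun t : B.points => t.1 n i :=
  (continuous_apply i).comp ((continuous_apply n).comp continuous_subtype_val)

instance : CompactSpace B.points := isCompact_iff_compactSpace.1 isCompact_points

theorem step_loc_of_step {n : ℕ} {v w : ℕ × ℕ} (hv : B.Valid (n + 1) v)
    (h : B.Step (n + 1) v w) : B.Step n (B.loc n v) (B.loc n w) := by
  obtain ⟨b, j⟩ := v
  obtain ⟨-, hj⟩ := hv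
  simp only at hj
  rcases Nat.lt_or_ge (j + 1) (B.h (n + 1) b) with hlt | hge
  · rw [h.1 hlt]
    exact step_loc hlt
  · have hw : w = (w.1, 0) := Prod.ext rfl (h.2 (by simp only; omega))
    have hj' : j = B.h (n + 1) b - 1 := by omega
    have hh := B.h_pos n (B.d n - 1)
    rw [hw, hj', loc_zero, loc_top]
    refine ⟨fun h1 => ?_, fun _ => rfl⟩
    simp only at h1
    omega

theorem exists_partial_point (N : ℕ) : ∀ s : ℤ → ℕ × ℕ, (∀ i, B.Valid N (s i)) →
    (∀ i, B.Step N (s i) (s (i + 1))) → ∃ t : ℕ → ℤ → ℕ × ℕ, t N = s ∧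
      (∀ n i, B.Valid n (t n i)) ∧ (∀ n ≤ N, ∀ i, B.Step n (t n i) (t n (i + 1))) ∧
      (∀ n < N, ∀ i, B.loc n (t (n + 1) i) = t n i) := by
  induction N with
  | zero =>
    intro s hs1 hs2
    refine ⟨fun n i => if n = 0 then s i else (0, 0), rfl, fun n i => ?_, fun n hn i => ?_,
      fun n hn => absurd hn (Nat.not_lt_zero n)⟩
    · dsimp only
      split_ifs with h
      · exact h ▸ hs1 i
      · exact ⟨B.d_pos n, B.h_pos n 0⟩
    · obtain rfl : n = 0 := by omega
      exact hs2 i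
  | succ N ih =>
    intro s hs1 hs2
    obtain ⟨t, ht0, ht1, ht2, ht3⟩ := ih (fun i => B.loc N (s i)) (fun i => valid_loc _ _)
      (fun i => step_loc_of_step (hs1 i) (hs2 i))
    refine ⟨Function.update t (N + 1) s, Function.update_self .., fun n i => ?_,
      fun n hn i => ?_, fun n hn i => ?_⟩
    · rcases eq_or_ne n (N + 1) with rfl | hne
      · rw [Function.update_self]; exact hs1 i
      · rw [Function.update_of_ne hne]; exact ht1 n i
    · rcases eq_or_ne n (N + 1) with rfl | hne
      · rw [Function.update_self]; exact hs2 i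
      · rw [Function.update_of_ne hne]; exact ht2 n (by omega) i
    · rw [Function.update_of_ne (a := n) (by omega)]
      rcases eq_or_ne n N with rfl | hne
      · rw [Function.update_self, ht0]
      · rw [Function.update_of_ne (by omega)]; exact ht3 n (by omega) i

theorem points_nonempty : B.points.Nonempty := by
  let F : ℕ → Set (ℕ → ℤ → ℕ × ℕ) := fun N => B.validBox ∩
    ((⋂ n, ⋂ (_ : n ≤ N), ⋂ i, {t | B.Step n (t n i) (t n (i + 1))}) ∩
      (⋂ n, ⋂ (_ : n < N), ⋂ i, {t | B.loc n (t (n + 1) i) = t n i}))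
  have hcl : ∀ N, IsClosed (F N) := by
    intro N
    refine isCompact_validBox.isClosed.inter (IsClosed.inter ?_ ?_) <;>
      refine isClosed_iInter fun n => isClosed_iInter fun _ => isClosed_iInter fun i => ?_
    · exact (isClosed_discrete {p : (ℕ × ℕ) × (ℕ × ℕ) | B.Step n p.1 p.2}).preimage
        (f := fun t : ℕ → ℤ → ℕ × ℕ => (t n i, t n (i + 1))) (by fun_prop)
    · exact (isClosed_discrete {p : (ℕ × ℕ) × (ℕ × ℕ) | B.loc n p.1 = p.2}).preimage
        (f := fun t : ℕ → ℤ → ℕ × ℕ => (t (n + 1) i, t n i)) (by fun_prop)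
  have hne : ∀ N, (F N).Nonempty := by
    intro N
    have hh := B.h_pos N 0
    obtain ⟨t, -, h1, h2, h3⟩ := exists_partial_point (B := B) N
      (fun i => (0, (i % (B.h N 0 : ℤ)).toNat)) (fun i => ⟨B.d_pos N, by
        have h1 := Int.emod_lt_of_pos i (b := (B.h N 0 : ℤ)) (by omega)
        have h2 := Int.emod_nonneg i (b := (B.h N 0 : ℤ)) (by omega)
        simp only
        omega⟩)
      (fun i => by
        have h1 := Int.emod_lt_of_pos i (b := (B.h N 0 : ℤ)) (by omega)
        have h2 := Int.emod_nonneg i (b := (B.h N 0 : ℤ)) (by omega)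
        have h3 := Int.emod_add_emod i (B.h N 0 : ℤ) 1
        constructor
        · intro h4
          simp only at h4 ⊢
          rw [← h3, Int.emod_eq_of_lt (by omega) (by omega)]
          congr 1
          omega
        · intro h4
          simp only at h4 ⊢
          rw [← h3, show i % (B.h N 0 : ℤ) + 1 = (B.h N 0 : ℤ) by omega]
          simp)
    refine ⟨t, fun n _ i _ => h1 n i, ?_, ?_⟩
    · simp only [Set.mem_iInter]; exact fun n hn i => h2 n hn i
    · simp only [Set.mem_iInter]; exact fun n hn i => h3 n hn i
  have hanti : ∀ N, F (N + 1) ⊆ F N := by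
    rintro N t ⟨h1, h2, h3⟩
    simp only [Set.mem_iInter] at h2 h3
    refine ⟨h1, ?_, ?_⟩ <;> simp only [Set.mem_iInter]
    · exact fun n hn i => h2 n (by omega) i
    · exact fun n hn i => h3 n (by omega) i
  obtain ⟨t, ht⟩ := IsCompact.nonempty_iInter_of_sequence_nonempty_isCompact_isClosed F hanti hne
    (isCompact_validBox.of_isClosed_subset (hcl 0) Set.inter_subset_left) hcl
  rw [Set.mem_iInter] at ht
  refine ⟨t, fun n i => (ht 0).1 n trivial i trivial, fun n i => ?_, fun n i => ?_⟩
  · have := (ht n).2.1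
    simp only [Set.mem_iInter] at this
    exact this n le_rfl i
  · have := (ht (n + 1)).2.2
    simp only [Set.mem_iInter] at this
    exact this n (by omega) i

/-- Conditions under which the sequence of letters of level `0` determines all addresses. -/
structure Recognizable (B : TowerData) : Prop where
  two_le_d : ∀ n, 2 ≤ B.d n
  d_zero : B.d 0 = 2
  h_zero : ∀ a, B.h 0 a = 1
  row_inj : ∀ n b b', b < B.d (n + 1) → b' < B.d (n + 1) →
    (∀ a < B.d n, B.A n b a = B.A n b' a) → b = b'

theorem Recognizable.lt_h (hB : B.Recognizable) : ∀ n a, n < B.h n a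
  | 0, a => B.h_pos 0 a
  | n + 1, b => by
    rw [B.h_succ]
    have h1 : ∑ a ∈ Finset.range (B.d n), (n + 1) ≤
        ∑ a ∈ Finset.range (B.d n), B.A n b a * B.h n a :=
      Finset.sum_le_sum fun a _ =>
        le_trans (lt_h hB n a) (Nat.le_mul_of_pos_left _ (B.A_pos n b a))
    have h2 : 2 * (n + 1) ≤ ∑ a ∈ Finset.range (B.d n), (n + 1) := by
      simpa using Nat.mul_le_mul_right (n + 1) (hB.two_le_d n)
    omega

namespace IsPoint

variable {t t' : ℕ → ℤ → ℕ × ℕ}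

theorem bottom_iff (hB : B.Recognizable) (ht : B.IsPoint t) (n : ℕ) (i : ℤ) :
    (t (n + 1) i).2 = 0 ↔ ((t n (i - 1)).1 = B.d n - 1 ∧ (t n i).1 = 0) := by
  constructor
  · intro h
    refine ⟨by rw [ht.pred_letter_of_bottom h], ?_⟩
    have := ht.add_of_bottom h (B.h_pos n 0)
    simp only [Nat.cast_zero, add_zero] at this
    rw [this]
  · rintro ⟨h1, h2⟩
    by_contra hne
    obtain ⟨j, hj⟩ := Nat.exists_eq_succ_of_ne_zero hne
    have e1 : t (n + 1) i = ((t (n + 1) i).1, j + 1) := Prod.ext rfl hj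
    have e2 := ht.pred_of_succ e1
    rw [← ht.loc, e2] at h1
    rw [← ht.loc, e1] at h2
    change B.letter n _ _ = _ at h1
    change B.letter n _ _ = _ at h2
    have := letter_mono (B := B) n (t (n + 1) i).1 (Nat.le_succ j)
    have := hB.two_le_d n
    simp only [Nat.succ_eq_add_one] at *
    omega

theorem level_succ_le (hB : B.Recognizable) (ht : B.IsPoint t) (ht' : B.IsPoint t') {n : ℕ}
    (h : t n = t' n) (i : ℤ) : (t (n + 1) i).2 ≤ (t' (n + 1) i).2 := by
  by_contra! hlt
  have e1 := ht'.sub (n := n + 1) (i := i) rfl _ le_rfl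
  have e2 := ht.sub (n := n + 1) (i := i) rfl (t' (n + 1) i).2 hlt.le
  have h1 : (t' (n + 1) (i - (t' (n + 1) i).2)).2 = 0 := by rw [e1]; simp
  rw [ht'.bottom_iff hB, ← h, ← ht.bottom_iff hB, e2] at h1
  simp only at h1
  omega

theorem height_le (hB : B.Recognizable) (ht : B.IsPoint t) (ht' : B.IsPoint t') {n : ℕ}
    (h : t n = t' n) (i : ℤ) (hi : (t (n + 1) i).2 = 0) (hi' : (t' (n + 1) i).2 = 0) :
    B.h (n + 1) (t (n + 1) i).1 ≤ B.h (n + 1) (t' (n + 1) i).1 := by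
  by_contra! hlt
  have e0 : t (n + 1) i = ((t (n + 1) i).1, 0) := Prod.ext rfl hi
  have e0' : t' (n + 1) i = ((t' (n + 1) i).1, 0) := Prod.ext rfl hi'
  have e1 := ht.add e0 (B.h (n + 1) (t' (n + 1) i).1) (by omega)
  have h1 := ht'.add_height e0' (B.h (n + 1) (t' (n + 1) i).1) (by omega)
  rw [ht'.bottom_iff hB, ← h, ← ht.bottom_iff hB, e1] at h1
  have := B.h_pos (n + 1) (t' (n + 1) i).1
  simp only at h1
  omega

theorem level_succ_eq (hB : B.Recognizable) (ht : B.IsPoint t) (ht' : B.IsPoint t') {n : ℕ}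
    (h : t n = t' n) : t (n + 1) = t' (n + 1) := by
  funext i
  have hj : (t (n + 1) i).2 = (t' (n + 1) i).2 :=
    le_antisymm (level_succ_le hB ht ht' h i) (level_succ_le hB ht' ht h.symm i)
  refine Prod.ext ?_ hj
  set b := (t (n + 1) i).1 with hb
  set b' := (t' (n + 1) i).1 with hb'
  have e1 : t (n + 1) (i - (t (n + 1) i).2) = (b, 0) := by
    rw [ht.sub (n := n + 1) (i := i) rfl _ le_rfl]; simp [hb]
  have e2 : t' (n + 1) (i - (t (n + 1) i).2) = (b', 0) := by
    rw [hj, ht'.sub (n := n + 1) (i := i) rfl _ le_rfl]; simp [hb']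
  set k := i - ((t (n + 1) i).2 : ℤ)
  have hh : B.h (n + 1) b = B.h (n + 1) b' := by
    have h1 := height_le hB ht ht' h k (by rw [e1]) (by rw [e2])
    have h2 := height_le hB ht' ht h.symm k (by rw [e2]) (by rw [e1])
    rw [e1, e2] at h1 h2
    exact le_antisymm h1 h2
  refine hB.row_inj n b b' (ht.valid _ _).1 (ht'.valid _ _).1 fun a ha => ?_
  have key : (B.A n b a : ℤ) = B.A n b' a := by
    rw [← sum_loc_base n b a ha, ← sum_loc_base n b' a ha, ← hh]
    refine Finset.sum_congr rfl fun s hs => ?_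
    have hs := Finset.mem_range.1 hs
    have f1 := ht.add e1 s (by omega)
    have f2 := ht'.add e2 s (by omega)
    rw [zero_add] at f1 f2
    rw [← f1, ← f2, ht.loc, ht'.loc, h]
  exact_mod_cast key

end IsPoint

/-- The sequence of letters of level `0`. -/
def code (t : ℕ → ℤ → ℕ × ℕ) (i : ℤ) : Bool := decide ((t 0 i).1 = 1)

theorem continuous_code : Continuous code :=
  continuous_pi fun i =>
    (continuous_of_discreteTopology (f := fun v : ℕ × ℕ => decide (v.1 = 1))).comp
      (by fun_prop : Continuous fun t : ℕ → ℤ → ℕ × ℕ => t 0 i)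

theorem Recognizable.code_injOn (hB : B.Recognizable) : Set.InjOn code B.points := by
  intro t ht t' ht' h
  funext n
  induction n with
  | zero =>
    funext i
    have h1 := congrFun h i
    have hv := ht.valid 0 i
    have hv' := ht'.valid 0 i
    rw [Valid, hB.d_zero, hB.h_zero] at hv hv'
    simp only [code, decide_eq_decide] at h1
    exact Prod.ext (by omega) (by omega)
  | succ n ih => exact IsPoint.level_succ_eq hB ht ht' ih

variable (B) in
/-- The subshift of all sequences of letters of level `0`. -/
def subshift : Subshift Bool ℤ where
  carrier := code '' B.points
  isClosed := (isCompact_points.image continuous_code).isClosed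
  mapsTo := by
    rintro g _ ⟨t, ht, rfl⟩
    exact ⟨fun n i => t n (g + i), IsPoint.shift ht g, rfl⟩

/-- The subshift is homeomorphic to the space of systems of addresses. -/
noncomputable def Recognizable.codeHomeo (hB : B.Recognizable) :
    B.points ≃ₜ B.subshift.carrier :=
  Continuous.homeoOfEquivCompactToT2 (f := hB.code_injOn.bijOn_image.equiv) <|
    (continuous_code.comp continuous_subtype_val).subtype_mk _

theorem Recognizable.codeHomeo_apply (hB : B.Recognizable) (t : B.points) :
    (hB.codeHomeo t : ℤ → Bool) = code t.1 := rfl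

theorem Recognizable.codeHomeo_symm_shiftMap (hB : B.Recognizable) (y : B.subshift.carrier) (n : ℕ)
    (i : ℤ) : (hB.codeHomeo.symm (DimGroup.shiftMap B.subshift y)).1 n i =
      (hB.codeHomeo.symm y).1 n (1 + i) := by
  obtain ⟨t, rfl⟩ := hB.codeHomeo.surjective y
  have : DimGroup.shiftMap B.subshift (hB.codeHomeo t) =
      hB.codeHomeo ⟨fun n i => t.1 n (1 + i), IsPoint.shift t.2 1⟩ := by
    apply Subtype.ext
    rw [codeHomeo_apply]
    rfl
  rw [this, Homeomorph.symm_apply_apply, Homeomorph.symm_apply_apply]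

theorem exists_window (f : C(B.points, ℤ)) : ∃ K : ℕ, ∀ t t' : B.points,
    (∀ m ≤ K, ∀ i : ℤ, |i| ≤ K → t.1 m i = t'.1 m i) → f t = f t' := by
  by_contra! hcon
  let D : ℕ → Set (B.points × B.points) := fun K =>
    {p | f p.1 ≠ f p.2} ∩ ⋂ m, ⋂ (_ : m ≤ K), ⋂ i : ℤ, ⋂ (_ : |i| ≤ K),
      {p | p.1.1 m i = p.2.1 m i}
  have hcl : ∀ K, IsClosed (D K) := by
    intro K
    refine IsClosed.inter ?_ (isClosed_iInter fun m => isClosed_iInter fun _ =>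
      isClosed_iInter fun i => isClosed_iInter fun _ => ?_)
    · exact (isClosed_discrete {q : ℤ × ℤ | q.1 ≠ q.2}).preimage
        (f := fun p : B.points × B.points => (f p.1, f p.2)) (by fun_prop)
    · exact isClosed_eq ((continuous_points_apply m i).comp continuous_fst)
        ((continuous_points_apply m i).comp continuous_snd)
  obtain ⟨p, hp⟩ := IsCompact.nonempty_iInter_of_sequence_nonempty_isCompact_isClosed D
    (by
      rintro K p ⟨h1, h2⟩
      simp only [Set.mem_iInter] at h2
      refine ⟨h1, ?_⟩
      simp only [Set.mem_iInter]
      exact fun m hm i hi => h2 m (by omega) i (by push_cast; omega))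
    (by
      intro K
      obtain ⟨t, t', h1, h2⟩ := hcon K
      refine ⟨(t, t'), h2, ?_⟩
      simp only [Set.mem_iInter]
      exact h1)
    (hcl 0).isCompact hcl
  rw [Set.mem_iInter] at hp
  refine (hp 0).1 (congrArg f (Subtype.ext ?_))
  funext m i
  have := (hp (max m i.natAbs)).2
  simp only [Set.mem_iInter] at this
  exact this m (le_max_left _ _) i (by push_cast; rw [Int.abs_eq_natAbs]; exact le_max_right _ _)

/-- The subshift is a system with nested tower partitions. -/
noncomputable def Recognizable.towerSystem (hB : B.Recognizable) :
    TowerSystem B (DimGroup.shiftMap B.subshift) where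
  addr n y := (hB.codeHomeo.symm y).1 n 0
  continuous_addr n := (continuous_points_apply n 0).comp hB.codeHomeo.symm.continuous
  valid n y := (hB.codeHomeo.symm y).2.valid n 0
  step n y := by
    rw [hB.codeHomeo_symm_shiftMap]
    simpa using IsPoint.step (hB.codeHomeo.symm y).2 n 0
  loc_addr n y := (hB.codeHomeo.symm y).2.loc n 0
  separates f := by
    obtain ⟨K, hK⟩ := exists_window (f.comp (hB.codeHomeo : C(B.points, B.subshift.carrier)))
    refine ⟨K + 1, fun n hn y y' h => ?_⟩
    obtain ⟨n, rfl⟩ : ∃ m, n = m + 1 := ⟨n - 1, by omega⟩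
    have h1 := hB.lt_h n 0
    have h2 := hB.lt_h n (B.d n - 1)
    have key := IsPoint.eq_of_addr (hB.codeHomeo.symm y).2 (hB.codeHomeo.symm y').2 (K := K) h
      (by omega) (by omega)
    have := hK (hB.codeHomeo.symm y) (hB.codeHomeo.symm y') fun m hm i hi =>
      IsPoint.eq_of_le (hB.codeHomeo.symm y).2 (hB.codeHomeo.symm y').2 (by omega : m ≤ n)
        (key i hi)
    simpa using this

instance : CompactSpace B.subshift.carrier :=
  isCompact_iff_compactSpace.1 (isCompact_points.image continuous_code)

instance : Nonempty B.subshift.carrier := (points_nonempty.image code).to_subtype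

end TowerData

/-! ### Complexity of the subshift -/

namespace TowerData

variable {B : TowerData}

theorem Step.right_unique {n : ℕ} {v w w' : ℕ × ℕ} (hv : B.Valid n v) (h : B.Step n v w)
    (h' : B.Step n v w') (hw : w.1 = w'.1) : w = w' := by
  rcases Nat.lt_or_ge (v.2 + 1) (B.h n v.1) with hlt | hge
  · rw [h.1 hlt, h'.1 hlt]
  · have := hv.2
    exact Prod.ext hw (by rw [h.2 (by omega), h'.2 (by omega)])

theorem Step.left_unique {n : ℕ} {v v' w : ℕ × ℕ} (hv : B.Valid n v) (hv' : B.Valid n v')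
    (h : B.Step n v w) (h' : B.Step n v' w) (hvv : v.1 = v'.1) : v = v' := by
  obtain ⟨a, r⟩ := v
  obtain ⟨a', r'⟩ := v'
  simp only at hvv
  subst hvv
  have h1 := hv.2
  have h2 := hv'.2
  simp only at h1 h2
  congr 1
  rcases Nat.lt_or_ge (r + 1) (B.h n a) with hlt | hge <;>
    rcases Nat.lt_or_ge (r' + 1) (B.h n a) with hlt' | hge'
  · have := (h.1 hlt).symm.trans (h'.1 hlt')
    simpa using this
  · have e1 := h.1 hlt
    have e2 := h'.2 (by simp only; omega)
    rw [e1] at e2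
    simp at e2
  · have e1 := h'.1 hlt'
    have e2 := h.2 (by simp only; omega)
    rw [e1] at e2
    simp at e2
  · omega

namespace IsPoint

variable {t t' : ℕ → ℤ → ℕ × ℕ}

/-- Two points with the same letters in a window and the same address somewhere in the window
have the same addresses in the window. -/
theorem eq_on_window (ht : B.IsPoint t) (ht' : B.IsPoint t') {k m s : ℕ} (hs : s < m)
    (hl : ∀ i : ℕ, i < m → (t k i).1 = (t' k i).1) (h : t k s = t' k s) :
    ∀ i : ℕ, i < m → t k i = t' k i := by
  have fwd : ∀ e : ℕ, s + e < m → t k (s + e : ℕ) = t' k (s + e : ℕ) := by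
    intro e
    induction e with
    | zero => intro _; simpa using h
    | succ e ih =>
      intro he
      have h1 := ih (by omega)
      have s1 := ht.step k (s + e : ℕ)
      have s2 := ht'.step k (s + e : ℕ)
      rw [← h1] at s2
      have h3 := hl _ he
      have hc : ((s + (e + 1) : ℕ) : ℤ) = ((s + e : ℕ) : ℤ) + 1 := by push_cast; ring
      rw [hc] at h3 ⊢
      exact Step.right_unique (ht.valid k _) s1 s2 h3
  have bwd : ∀ e : ℕ, e ≤ s → t k (s - e : ℕ) = t' k (s - e : ℕ) := by
    intro e
    induction e with
    | zero => intro _; simpa using h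
    | succ e ih =>
      intro he
      have h1 := ih (by omega)
      have hc : ((s - e : ℕ) : ℤ) = ((s - (e + 1) : ℕ) : ℤ) + 1 := by omega
      have s1 := ht.step k (s - (e + 1) : ℕ)
      have s2 := ht'.step k (s - (e + 1) : ℕ)
      rw [← hc] at s1 s2
      rw [← h1] at s2
      exact Step.left_unique (ht.valid k _) (ht'.valid k _) s1 s2 (hl _ (by omega))
  intro i hi
  rcases Nat.lt_or_ge i s with hlt | hge
  · have := bwd (s - i) (by omega)
    rwa [show s - (s - i) = i by omega] at this
  · have := fwd (i - s) (by omega)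
    rwa [show s + (i - s) = i by omega] at this

/-- The addresses at a position where the letter changes. -/
theorem of_change (ht : B.IsPoint t) {k : ℕ} {s : ℤ} (h : (t k s).1 ≠ (t k (s - 1)).1) :
    (t k s).2 = 0 ∧ (t k s).1 = ((t k (s - 1)).1 + 1) % B.d k ∧
      t (k + 1) s = ((t (k + 1) s).1, B.pos k (t (k + 1) s).1 (t k s).1) := by
  have hd := B.d_pos k
  obtain ⟨b, j, hb⟩ : ∃ b j, t (k + 1) s = (b, j) := ⟨_, _, rfl⟩
  have hv := (ht.valid (k + 1) s).2
  rw [hb] at hv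
  simp only at hv
  rcases Nat.eq_zero_or_pos j with rfl | hj
  · have h1 := ht.pred_letter_of_bottom (n := k) (i := s) (by rw [hb])
    have h2 : t k s = (0, 0) := by rw [← ht.loc, hb, loc_zero]
    rw [h1, h2, hb]
    simp [pos_zero, Nat.sub_add_cancel hd]
  · obtain ⟨j, rfl⟩ : ∃ j', j = j' + 1 := ⟨j - 1, by omega⟩
    have h1 := ht.pred_of_succ hb
    have e1 : t k s = B.loc k (b, j + 1) := by rw [← ht.loc, hb]
    have e2 : t k (s - 1) = B.loc k (b, j) := by rw [← ht.loc, h1]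
    rw [e1, e2] at h ⊢
    rcases loc_succ hv with ⟨h2, -⟩ | ⟨h2, -, h3, h4⟩
    · exact absurd h2 h
    · refine ⟨h4, ?_, ?_⟩
      · change B.letter k b (j + 1) = (B.letter k b j + 1) % B.d k
        rw [← h2, Nat.mod_eq_of_lt (letter_lt _ _ _)]
      · rw [hb]
        exact Prod.ext rfl h3

/-- After a change the letter stays the same for a long time. -/
theorem letter_add_of_change (ht : B.IsPoint t) {k : ℕ} {s : ℤ}
    (h : (t k s).1 ≠ (t k (s - 1)).1) {e : ℕ}
    (he : e < B.A k (t (k + 1) s).1 (t k s).1) : (t k (s + e)).1 = (t k s).1 := by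
  obtain ⟨-, -, h3⟩ := ht.of_change h
  set b := (t (k + 1) s).1
  set a := (t k s).1 with ha
  have had : a < B.d k := (ht.valid k s).1
  have he' : e < B.A k b a * B.h k a :=
    lt_of_lt_of_le he (Nat.le_mul_of_pos_right _ (B.h_pos k a))
  have hlt : B.pos k b a + e < B.h (k + 1) b := by
    have := (pos_strictMono (B := B) k b).monotone (Nat.succ_le_of_lt had)
    rw [Nat.succ_eq_add_one, pos_succ, pos_d] at this
    omega
  rw [← ht.loc, ht.add h3 e hlt]
  exact letter_pos_add had he'

theorem const_or_change (t : ℕ → ℤ → ℕ × ℕ) (k m : ℕ) :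
    (∀ i : ℕ, i < m → (t k i).1 = (t k 0).1) ∨
      ∃ s : ℕ, 0 < s ∧ s < m ∧ (t k s).1 ≠ (t k (s - 1)).1 ∧
        ∀ i : ℕ, i < s → (t k i).1 = (t k 0).1 := by
  classical
  by_cases hc : ∀ i : ℕ, i < m → (t k i).1 = (t k 0).1
  · exact Or.inl hc
  right
  push Not at hc
  have hs := Nat.find_spec hc
  have hmin : ∀ i : ℕ, i < Nat.find hc → (t k i).1 = (t k 0).1 := by
    intro i hi
    by_contra hne
    exact Nat.find_min hc hi ⟨by omega, hne⟩
  have hpos : 0 < Nat.find hc := by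
    rcases Nat.eq_zero_or_pos (Nat.find hc) with h0 | h0
    · rw [h0] at hs
      exact absurd rfl hs.2
    · exact h0
  refine ⟨Nat.find hc, hpos, hs.1, ?_, hmin⟩
  have := hmin (Nat.find hc - 1) (by omega)
  rw [Nat.cast_sub (by omega), Nat.cast_one] at this
  rw [this]
  exact hs.2

end IsPoint

/-- Parameters that determine the addresses of a point in the window `[0, m)`: either the letter
of level `n` is constant in the window, or that of level `n + 1` is, or the latter changes once. -/
abbrev WindowCode (B : TowerData) (n m : ℕ) : Type :=
  (Fin (B.d n) × Fin (∑ a ∈ Finset.range (B.d n), B.h n a)) ⊕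
    (Fin (B.d (n + 1)) × Fin (B.d n) × Fin m) ⊕ (Fin (B.d (n + 1)) × Fin m)

/-- The point `t` has the window code `p`. -/
def HasWindowCode (B : TowerData) (n m : ℕ) (t : ℕ → ℤ → ℕ × ℕ) : WindowCode B n m → Prop
  | .inl (a, r) => (∀ i : ℕ, i < m → (t n i).1 = a) ∧ t n 0 = (↑a, ↑r)
  | .inr (.inl (a, a', s)) => (∀ i : ℕ, i < m → (t (n + 1) i).1 = a) ∧
      t (n + 1) (s : ℕ) = (↑a, B.pos n a ((a' + 1) % B.d n))
  | .inr (.inr (a, s)) => (∀ i : ℕ, i < s → (t (n + 1) i).1 = a) ∧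
      (∀ i : ℕ, (s : ℕ) ≤ i → i < m → (t (n + 1) i).1 = (a + 1) % B.d (n + 1)) ∧
      t (n + 1) (s : ℕ) = ((a + 1) % B.d (n + 1), 0)

theorem exists_hasWindowCode {n m : ℕ} (hm : ∀ b a, b < B.d (n + 2) → a < B.d (n + 1) →
    m ≤ B.A (n + 1) b a) {t : ℕ → ℤ → ℕ × ℕ} (ht : B.IsPoint t) :
    ∃ p, HasWindowCode B n m t p := by
  rcases IsPoint.const_or_change t n m with h | ⟨s, hs0, hsm, hs, -⟩
  · obtain ⟨h1, h2⟩ := ht.valid n 0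
    refine ⟨.inl (⟨_, h1⟩, ⟨(t n 0).2, lt_of_lt_of_le h2 ?_⟩), h, rfl⟩
    exact Finset.single_le_sum (f := fun a => B.h n a) (fun _ _ => Nat.zero_le _)
      (Finset.mem_range.2 h1)
  rcases IsPoint.const_or_change t (n + 1) m with h | ⟨s', hs0', hsm', hs', hc⟩
  · obtain ⟨-, h2, h3⟩ := ht.of_change hs
    refine ⟨.inr (.inl (⟨_, (ht.valid (n + 1) 0).1⟩, ⟨_, (ht.valid n (s - 1)).1⟩, ⟨s, hsm⟩)),
      h, ?_⟩
    rw [h3, h s hsm, h2]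
  · obtain ⟨h1, h2, -⟩ := ht.of_change hs'
    have h0 : (t (n + 1) (s' - 1)).1 = (t (n + 1) 0).1 := by
      have := hc (s' - 1) (by omega)
      rwa [Nat.cast_sub (by omega), Nat.cast_one] at this
    rw [h0] at h2
    refine ⟨.inr (.inr (⟨_, (ht.valid (n + 1) 0).1⟩, ⟨s', hsm'⟩)), hc, fun i hi him => ?_, ?_⟩
    · have hle := hm _ _ (ht.valid (n + 2) s').1 (ht.valid (n + 1) s').1
      simp only at hi
      have := ht.letter_add_of_change hs' (e := i - s') (lt_of_lt_of_le (by omega) hle)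
      rw [show (s' : ℤ) + ((i - s' : ℕ) : ℤ) = i by omega] at this
      rw [this, h2]
    · exact Prod.ext h2 h1

theorem HasWindowCode.eq_on_window {n m : ℕ} {t t' : ℕ → ℤ → ℕ × ℕ} (ht : B.IsPoint t)
    (ht' : B.IsPoint t') {p : WindowCode B n m} (h : HasWindowCode B n m t p)
    (h' : HasWindowCode B n m t' p) {i : ℕ} (hi : i < m) : t 0 i = t' 0 i := by
  rcases p with ⟨a, r⟩ | ⟨a, a', s⟩ | ⟨a, s⟩
  · refine ht.eq_of_le ht' (Nat.zero_le n) ?_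
    refine ht.eq_on_window ht' (s := 0) (by omega : 0 < m)
      (fun i hi => (h.1 i hi).trans (h'.1 i hi).symm) ?_ i hi
    exact h.2.trans h'.2.symm
  · refine ht.eq_of_le ht' (Nat.zero_le (n + 1)) ?_
    exact ht.eq_on_window ht' s.2 (fun i hi => (h.1 i hi).trans (h'.1 i hi).symm)
      (h.2.trans h'.2.symm) i hi
  · refine ht.eq_of_le ht' (Nat.zero_le (n + 1)) ?_
    refine ht.eq_on_window ht' s.2 (fun i hi => ?_) (h.2.2.trans h'.2.2.symm) i hi
    rcases Nat.lt_or_ge i s with hlt | hge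
    · exact (h.1 i hlt).trans (h'.1 i hlt).symm
    · exact (h.2.1 i hge hi).trans (h'.2.1 i hge hi).symm

/-- If `m` is at most the lengths of the runs of level `n + 1`, then the number of words of
length `m` is bounded linearly in `m`, by constants depending on the levels `n` and `n + 1`. -/
theorem complexity_le {n m : ℕ} (hm : ∀ b a, b < B.d (n + 2) → a < B.d (n + 1) →
    m ≤ B.A (n + 1) b a) :
    DimGroup.complexity B.subshift m ≤ B.d n * (∑ a ∈ Finset.range (B.d n), B.h n a) +
      (B.d (n + 1) * (B.d n * m) + B.d (n + 1) * m) := by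
  have key : ∀ w ∈ DimGroup.language B.subshift m, ∃ p : WindowCode B n m,
      ∃ t, B.IsPoint t ∧ HasWindowCode B n m t p ∧ ∀ k : Fin m, w k = code t (k : ℕ) := by
    rintro w ⟨_, ⟨t, ht, rfl⟩, i, hw⟩
    have ht' := IsPoint.shift ht i
    obtain ⟨p, hp⟩ := exists_hasWindowCode hm ht'
    exact ⟨p, _, ht', hp, hw⟩
  classical
  let F : (Fin m → Bool) → Option (WindowCode B n m) := fun w =>
    if h : w ∈ DimGroup.language B.subshift m then some (key w h).choose else none
  have hF : ∀ w (h : w ∈ DimGroup.language B.subshift m), F w = some (key w h).choose :=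
    fun w h => dif_pos h
  have hcard := Set.ncard_le_ncard_of_injOn (s := DimGroup.language B.subshift m)
    (t := some '' (Set.univ : Set (WindowCode B n m))) F
    (fun w hw => ⟨_, trivial, (hF w hw).symm⟩)
    (by
      intro w hw w' hw' h
      rw [hF w hw, hF w' hw', Option.some_inj] at h
      obtain ⟨t, ht, hp, hwt⟩ := (key w hw).choose_spec
      obtain ⟨t', ht', hp', hwt'⟩ := (key w' hw').choose_spec
      rw [← h] at hp'
      funext k
      rw [hwt, hwt', code, code, hp.eq_on_window ht ht' hp' k.2])
    (Set.toFinite _)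
  refine hcard.trans ?_
  rw [Set.ncard_image_of_injective _ (Option.some_injective _), Set.ncard_univ,
    Nat.card_eq_fintype_card]
  simp

end TowerData

/-! ### Simple dimension groups -/

namespace DimGroup

variable {d : ℕ → ℕ} {A : ∀ i, Matrix (Fin (d (i + 1))) (Fin (d i)) ℤ}
  {G : Type*} [AddCommGroup G]

/-- A family of maps `ℤ ^ d i → G` that presents the ordered group `(G, Gp)` as the limit. -/
structure Presents (A : ∀ i, Matrix (Fin (d (i + 1))) (Fin (d i)) ℤ) (Gp : Set G)
    (θ : ∀ i, (Fin (d i) → ℤ) →+ G) : Prop where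
  d_pos : ∀ i, 1 ≤ d i
  A_pos : ∀ i j k, 0 < A i j k
  map_mulVec : ∀ i x, θ (i + 1) ((A i).mulVec x) = θ i x
  mem_iff : ∀ g, g ∈ Gp ↔ ∃ i x, (∀ j, 0 ≤ x j) ∧ θ i x = g
  eq_zero : ∀ i x, θ i x = 0 → ∃ j, ∃ h : i ≤ j, transition d A i j h x = 0

theorem exists_presents {Gp : Set G} (hd : ∀ i, 1 ≤ d i) (hA : ∀ i j k, 0 < A i j k)
    (h : OrderedIso Gp (LimitGroup.pos d A)) : ∃ θ, Presents A Gp θ := by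
  obtain ⟨φ, hφ⟩ := h
  let μ : ∀ i, (Fin (d i) → ℤ) →+ LimitGroup d A := fun i =>
    AddMonoidHom.mk' (LimitGroup.mk d A i) fun x y =>
      (DirectLimit.add_def (G := fun i => Fin (d i) → ℤ) (f := fun i j h => transition d A i j h)
        i x y).symm
  refine ⟨fun i => φ.symm.toAddMonoidHom.comp (μ i), hd, hA, fun i x => ?_, fun g => ?_,
    fun i x hx => ?_⟩
  · change φ.symm _ = φ.symm _
    congr 1
    have h1 := transition_succ d A i i le_rfl x
    rw [transition_self] at h1
    change LimitGroup.mk d A (i + 1) _ = LimitGroup.mk d A i x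
    rw [← h1]
    exact DirectLimit.mk_apply (f := fun i j h => transition d A i j h) i (i + 1) x i.le_succ
  · have h1 : g ∈ Gp ↔ φ g ∈ LimitGroup.pos d A := by
      rw [← hφ]
      exact (φ.injective.mem_set_image).symm
    rw [h1]
    constructor
    · rintro ⟨i, x, hx, h2⟩
      exact ⟨i, x, hx, by change φ.symm (LimitGroup.mk d A i x) = g; rw [h2]; simp⟩
    · rintro ⟨i, x, hx, rfl⟩
      exact ⟨i, x, hx, by change _ = φ (φ.symm (LimitGroup.mk d A i x)); simp⟩
  · change φ.symm (LimitGroup.mk d A i x) = 0 at hx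
    rw [map_eq_zero_iff _ φ.symm.injective] at hx
    exact (DirectLimit.exists_eq_zero (G := fun i => Fin (d i) → ℤ)
      (f := fun i j h => transition d A i j h) ⟨i, x⟩).1 hx

namespace Presents

variable {Gp : Set G} {θ : ∀ i, (Fin (d i) → ℤ) →+ G}

theorem map_transition (h : Presents A Gp θ) {i j : ℕ} (hij : i ≤ j) (x : Fin (d i) → ℤ) :
    θ j (transition d A i j hij x) = θ i x := by
  induction j, hij using Nat.le_induction with
  | base => rw [transition_self]
  | succ j hij ih => rw [transition_succ d A i j hij, h.map_mulVec, ih]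

theorem le_mulVec (h : Presents A Gp θ) {i : ℕ} {m : ℤ} (hm : 0 ≤ m) {x : Fin (d i) → ℤ}
    (hx : ∀ c, m ≤ x c) (b : Fin (d (i + 1))) : m ≤ (A i).mulVec x b := by
  have hd := h.d_pos i
  have h1 : ∀ c, m ≤ A i b c * x c := fun c =>
    (hx c).trans (le_mul_of_one_le_left (hm.trans (hx c)) (h.A_pos i b c))
  calc m ≤ A i b ⟨0, hd⟩ * x ⟨0, hd⟩ := h1 _
    _ ≤ ∑ c, A i b c * x c :=
      Finset.single_le_sum (f := fun c => A i b c * x c) (fun c _ => hm.trans (h1 c))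
        (Finset.mem_univ _)

theorem le_transition (h : Presents A Gp θ) {i j : ℕ} (hij : i ≤ j) {m : ℤ} (hm : 0 ≤ m)
    {x : Fin (d i) → ℤ} (hx : ∀ c, m ≤ x c) (b : Fin (d j)) :
    m ≤ transition d A i j hij x b := by
  induction j, hij using Nat.le_induction with
  | base => rw [transition_self]; exact hx b
  | succ j hij ih =>
    rw [transition_succ d A i j hij]
    exact h.le_mulVec hm ih b

theorem one_le_mulVec (h : Presents A Gp θ) {i : ℕ} {x : Fin (d i) → ℤ} (hx : ∀ c, 0 ≤ x c)
    (hx0 : x ≠ 0) (b : Fin (d (i + 1))) : 1 ≤ (A i).mulVec x b := by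
  obtain ⟨c, hc⟩ := Function.ne_iff.1 hx0
  have h1 : 1 ≤ x c := lt_of_le_of_ne (hx c) (Ne.symm hc)
  calc (1 : ℤ) ≤ A i b c * x c := one_le_mul_of_one_le_of_one_le (h.A_pos i b c) h1
    _ ≤ ∑ c, A i b c * x c :=
      Finset.single_le_sum (f := fun c => A i b c * x c)
        (fun c _ => mul_nonneg (h.A_pos i b c).le (hx c)) (Finset.mem_univ c)

theorem one_le_transition (h : Presents A Gp θ) {i j : ℕ} (hij : i ≤ j) (hlt : i < j)
    {x : Fin (d i) → ℤ} (hx : ∀ c, 0 ≤ x c) (hx0 : x ≠ 0) (b : Fin (d j)) :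
    1 ≤ transition d A i j hij x b := by
  induction j, hlt using Nat.le_induction with
  | base =>
    rw [transition_succ d A i i le_rfl, transition_self]
    exact h.one_le_mulVec hx hx0 b
  | succ j hj ih =>
    rw [transition_succ d A i j (by omega)]
    exact h.le_mulVec zero_le_one (ih (by omega)) b

theorem ne_zero (h : Presents A Gp θ) {i : ℕ} {x : Fin (d i) → ℤ} (hx : ∀ c, 0 ≤ x c)
    (hx0 : x ≠ 0) : θ i x ≠ 0 := by
  intro h0
  obtain ⟨j, hij, hj⟩ := h.eq_zero i x h0
  have h1 := h.one_le_transition (hij.trans j.le_succ) (by omega) hx hx0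
    ⟨0, h.d_pos (j + 1)⟩
  rw [transition_succ d A i j hij, hj] at h1
  simp at h1

/-- The presentation does not become constant: the group is not cyclic. -/
def Growing (A : ∀ i, Matrix (Fin (d (i + 1))) (Fin (d i)) ℤ) : Prop :=
  ∀ i₀, ∃ i ≥ i₀, ¬ (d i = 1 ∧ ∀ j k, A i j k = 1)

theorem exists_doubling (h : Presents A Gp θ) (hA : Growing A) (i₀ : ℕ) :
    ∃ i ≥ i₀, ∀ (m : ℤ) (x : Fin (d i) → ℤ), 0 ≤ m → (∀ c, m ≤ x c) →
      ∀ b, 2 * m ≤ (A i).mulVec x b := by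
  have htwo : ∀ i, 2 ≤ d i → ∀ (m : ℤ) (x : Fin (d i) → ℤ), 0 ≤ m → (∀ c, m ≤ x c) →
      ∀ b, 2 * m ≤ (A i).mulVec x b := by
    intro i hi m x hm hx b
    calc 2 * m ≤ d i * m := mul_le_mul_of_nonneg_right (by exact_mod_cast hi) hm
      _ = ∑ c : Fin (d i), m := by simp
      _ ≤ ∑ c, A i b c * x c := Finset.sum_le_sum fun c _ =>
        (hx c).trans (le_mul_of_one_le_left (hm.trans (hx c)) (h.A_pos i b c))
  obtain ⟨i, hi, hne⟩ := hA i₀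
  rcases Nat.lt_or_ge (d i) 2 with h1 | h1
  · rcases Nat.lt_or_ge (d (i + 1)) 2 with h2 | h2
    · refine ⟨i, hi, fun m x hm hx b => ?_⟩
      have hd := h.d_pos i
      have hd' := h.d_pos (i + 1)
      push Not at hne
      obtain ⟨j, k, hjk⟩ := hne (by omega)
      obtain rfl : b = j := Fin.ext (by omega)
      have h3 := h.A_pos i b k
      have h4 : 2 ≤ A i b k := by omega
      calc 2 * m ≤ A i b k * x k := mul_le_mul h4 (hx k) hm (by omega)
        _ ≤ ∑ c, A i b c * x c :=
          Finset.single_le_sum (f := fun c => A i b c * x c)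
            (fun c _ => mul_nonneg (h.A_pos i b c).le (hm.trans (hx c))) (Finset.mem_univ k)
    · exact ⟨i + 1, by omega, htwo _ h2⟩
  · exact ⟨i, hi, htwo i h1⟩

theorem exists_le_transition (h : Presents A Gp θ) (hA : Growing A) {i : ℕ}
    {x : Fin (d i) → ℤ} (hx : ∀ c, 0 ≤ x c) (hx0 : x ≠ 0) (N : ℕ) :
    ∃ J, i ≤ J ∧ ∀ j (hij : i ≤ j), J ≤ j → ∀ b, (N : ℤ) ≤ transition d A i j hij x b := by
  induction N with
  | zero =>
    exact ⟨i, le_rfl, fun j hij _ b => by simpa using h.le_transition hij le_rfl hx b⟩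
  | succ N ih =>
    rcases Nat.eq_zero_or_pos N with rfl | hN
    · refine ⟨i + 1, i.le_succ, fun j hij hj b => ?_⟩
      simpa using h.one_le_transition hij (by omega) hx hx0 b
    obtain ⟨J, hJ, hN'⟩ := ih
    obtain ⟨k, hk, h2⟩ := h.exists_doubling hA J
    refine ⟨k + 1, by omega, fun j hij hj b => ?_⟩
    induction j, hj using Nat.le_induction with
    | base =>
      rw [transition_succ d A i k (by omega)]
      have := h2 N _ (by omega) (hN' k (by omega) hk) b
      push_cast
      omega
    | succ j hj ih =>
      rw [transition_succ d A i j (by omega)]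
      exact h.le_mulVec (by positivity) (ih (by omega)) b

theorem exists_add_mul_eq {p q n : ℕ} (hpq : p.Coprime q)
    (hn : p * q + p + q ≤ n) : ∃ x y : ℕ, 0 < x ∧ 0 < y ∧ p * x + q * y = n := by
  obtain ⟨a, b, hab⟩ := Nat.exists_add_mul_eq_of_gcd_dvd_of_mul_pred_le p q (n - p - q)
    (by simp [hpq.gcd_eq_one]) (by
      have : p.pred * q.pred ≤ p * q := Nat.mul_le_mul (Nat.pred_le _) (Nat.pred_le _)
      omega)
  refine ⟨a + 1, b + 1, by omega, by omega, ?_⟩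
  have h1 : p * (a + 1) = a * p + p := by ring
  have h2 : q * (b + 1) = b * q + q := by ring
  omega

theorem mem_of_nonneg (h : Presents A Gp θ) {i : ℕ} {x : Fin (d i) → ℤ} (hx : ∀ c, 0 ≤ x c) :
    θ i x ∈ Gp := (h.mem_iff _).2 ⟨i, x, hx, rfl⟩

theorem pos_of_one_le (h : Presents A Gp θ) {i : ℕ} {x : Fin (d i) → ℤ} (hx : ∀ c, 1 ≤ x c) :
    θ i x ∈ Gp ∧ θ i x ≠ 0 :=
  ⟨h.mem_of_nonneg fun c => zero_le_one.trans (hx c),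
    h.ne_zero (fun c => zero_le_one.trans (hx c)) fun h0 => by
      have := hx ⟨0, h.d_pos i⟩
      rw [h0] at this
      simp at this⟩

/-- A non-zero positive element of a non-cyclic simple dimension group is a combination of two
non-zero positive elements with any given coprime coefficients. -/
theorem exists_split (h : Presents A Gp θ) (hA : Growing A) {g : G} (hg : g ∈ Gp) (hg0 : g ≠ 0)
    {p q : ℕ} (hpq : p.Coprime q) :
    ∃ γ₀ γ₁ : G, (γ₀ ∈ Gp ∧ γ₀ ≠ 0) ∧ (γ₁ ∈ Gp ∧ γ₁ ≠ 0) ∧ g = p • γ₀ + q • γ₁ := by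
  obtain ⟨i, x, hx, rfl⟩ := (h.mem_iff g).1 hg
  have hx0 : x ≠ 0 := fun h0 => hg0 (by rw [h0, map_zero])
  obtain ⟨J, hJ, hN⟩ := h.exists_le_transition hA hx hx0 (p * q + p + q)
  have hN := hN J hJ le_rfl
  have key : ∀ b, ∃ y z : ℤ, 1 ≤ y ∧ 1 ≤ z ∧ transition d A i J hJ x b = p * y + q * z := by
    intro b
    obtain ⟨n, hn⟩ := Int.eq_ofNat_of_zero_le ((Int.natCast_nonneg _).trans (hN b))
    obtain ⟨y, z, hy, hz, hyz⟩ := exists_add_mul_eq hpq (n := n)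
      (by have := hN b; rw [hn] at this; exact_mod_cast this)
    exact ⟨y, z, by exact_mod_cast hy, by exact_mod_cast hz, by rw [hn, ← hyz]; push_cast; ring⟩
  choose y z hy hz hyz using key
  refine ⟨θ J y, θ J z, h.pos_of_one_le hy, h.pos_of_one_le hz, ?_⟩
  rw [← map_nsmul, ← map_nsmul, ← map_add, ← h.map_transition hJ]
  congr 1
  funext b
  simp [hyz]

theorem exists_kernel_level (h : Presents A Gp θ) {I k : ℕ} (w : Fin k → Fin (d I) → ℤ) :
    ∃ J, I ≤ J ∧ ∀ j (hj : I ≤ j), J ≤ j → ∀ x : Fin k → ℤ, ∑ a, x a • θ I (w a) = 0 →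
      transition d A I j hj (∑ a, x a • w a) = 0 := by
  let L : (Fin k → ℤ) →ₗ[ℤ] (Fin (d I) → ℤ) := Fintype.linearCombination ℤ w
  have hL : ∀ x, L x = ∑ a, x a • w a := fun x => Fintype.linearCombination_apply ℤ w x
  let K : Submodule ℤ (Fin k → ℤ) := LinearMap.ker ((θ I).toIntLinearMap.comp L)
  have hK : ∀ x, x ∈ K ↔ θ I (L x) = 0 := fun x => Iff.rfl
  obtain ⟨s, hs⟩ := IsNoetherian.noetherian K
  have hlev : ∀ x : Fin k → ℤ, ∃ J, x ∈ K → ∃ hj : I ≤ J, transition d A I J hj (L x) = 0 := by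
    intro x
    by_cases hx : x ∈ K
    · obtain ⟨J, hJ, h0⟩ := h.eq_zero I _ ((hK x).1 hx)
      exact ⟨J, fun _ => ⟨hJ, h0⟩⟩
    · exact ⟨0, fun h => absurd h hx⟩
  choose J hJ using hlev
  refine ⟨max I (s.sup J), le_max_left _ _, fun j hj hjJ x hx => ?_⟩
  have hxK : x ∈ K := by
    rw [hK, hL, map_sum, ← hx]
    exact Finset.sum_congr rfl fun a _ => map_zsmul _ _ _
  have hle : K ≤ LinearMap.ker ((transition d A I j hj).toIntLinearMap.comp L) := by
    rw [← hs, Submodule.span_le]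
    intro y hy
    obtain ⟨hy1, hy2⟩ := hJ y (hs ▸ Submodule.subset_span hy)
    have hyj : J y ≤ j := (Finset.le_sup (f := J) hy).trans ((le_max_right _ _).trans hjJ)
    change transition d A I j hj (L y) = 0
    have := (transition_directedSystem d A).map_map hy1 hyj (L y)
    rw [← this, hy2, map_zero]
  have := hle hxK
  change transition d A I j hj (L x) = 0 at this
  rwa [hL] at this

theorem eq_sum_single {i : ℕ} (θ : (Fin (d i) → ℤ) →+ G) (x : Fin (d i) → ℤ) :
    θ x = ∑ c, x c • θ (Pi.single c 1) := by
  conv_lhs => rw [pi_eq_sum_univ' x]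
  rw [map_sum]
  exact Finset.sum_congr rfl fun c _ => by
    rw [← map_zsmul]

/-- Finitely many non-zero positive elements are combinations, with positive coefficients, of
non-zero positive elements `g' c` such that all relations between the given elements hold for
the coefficients. A further positive element may be included. -/
theorem exists_refinement (h : Presents A Gp θ) {k : ℕ} {g : ℕ → G}
    (hg : ∀ a < k, g a ∈ Gp ∧ g a ≠ 0) {q : G} (hq : q ∈ Gp) :
    ∃ (m : ℕ) (g' : ℕ → G) (M : ℕ → ℕ → ℕ), 1 ≤ m ∧ (∀ c < m, g' c ∈ Gp ∧ g' c ≠ 0) ∧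
      (∀ c a, 0 < M c a) ∧ (∀ a < k, g a = ∑ c ∈ Finset.range m, M c a • g' c) ∧
      (∀ x : ℕ → ℤ, ∑ a ∈ Finset.range k, x a • g a = 0 →
        ∀ c < m, ∑ a ∈ Finset.range k, (M c a : ℤ) * x a = 0) ∧
      ∃ y : ℕ → ℤ, (∀ c, 0 ≤ y c) ∧ q = ∑ c ∈ Finset.range m, y c • g' c := by
  have hlift : ∀ a : Fin k, ∃ i x, (∀ j, 0 ≤ x j) ∧ θ i x = g a := fun a =>
    (h.mem_iff _).1 (hg a a.2).1
  choose lv v hv hvg using hlift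
  obtain ⟨lq, vq, hvq, hvqg⟩ := (h.mem_iff q).1 hq
  let I := max lq (Finset.univ.sup lv)
  have hlI : ∀ a, lv a ≤ I := fun a =>
    (Finset.le_sup (f := lv) (Finset.mem_univ a)).trans (le_max_right _ _)
  let w : Fin k → Fin (d I) → ℤ := fun a => transition d A (lv a) I (hlI a) (v a)
  have hw : ∀ a, θ I (w a) = g a := fun a => (h.map_transition _ _).trans (hvg a)
  have hwnn : ∀ a c, 0 ≤ w a c := fun a c => h.le_transition (hlI a) le_rfl (hv a) c
  have hw0 : ∀ a, w a ≠ 0 := fun a h0 => (hg a a.2).2 (by rw [← hw, h0, map_zero])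
  obtain ⟨J, hIJ, hJ⟩ := h.exists_kernel_level w
  let j := J + 1
  have hj : I ≤ j := by omega
  let W : Fin k → Fin (d j) → ℤ := fun a => transition d A I j hj (w a)
  have hW1 : ∀ a c, 1 ≤ W a c := fun a c =>
    h.one_le_transition hj (by omega) (hwnn a) (hw0 a) c
  have hWg : ∀ a, θ j (W a) = g a := fun a => (h.map_transition _ _).trans (hw a)
  let vq' := transition d A lq j ((le_max_left _ _).trans hj) vq
  have hker : ∀ x : Fin k → ℤ, ∑ a, x a • g a = 0 → ∀ c, ∑ a, W a c * x a = 0 := by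
    intro x hx c
    have h1 := hJ j hj (by omega) x (by rw [← hx]; exact Finset.sum_congr rfl fun a _ => by rw [hw])
    rw [map_sum] at h1
    have h2 := congrFun h1 c
    rw [Finset.sum_apply] at h2
    rw [← show _ = (0 : ℤ) from h2]
    refine Finset.sum_congr rfl fun a _ => ?_
    rw [map_zsmul]
    simp [W, mul_comm]
  refine ⟨d j, fun c => if hc : c < d j then θ j (Pi.single ⟨c, hc⟩ 1) else 0,
    fun c a => if hc : c < d j ∧ a < k then (W ⟨a, hc.2⟩ ⟨c, hc.1⟩).toNat else 1,
    h.d_pos j, ?_, ?_, ?_, ?_, ?_⟩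
  · intro c hc
    simp only [hc, dif_pos]
    have hnn : ∀ b, 0 ≤ (Pi.single ⟨c, hc⟩ 1 : Fin (d j) → ℤ) b := fun b => by
      by_cases hb : b = ⟨c, hc⟩
      · rw [hb, Pi.single_eq_same]; exact zero_le_one
      · rw [Pi.single_eq_of_ne hb]
    exact ⟨h.mem_of_nonneg hnn, h.ne_zero hnn fun h0 => by
      have := congrFun h0 ⟨c, hc⟩
      simp at this⟩
  · intro c a
    dsimp only
    split_ifs with hc
    · have := hW1 ⟨a, hc.2⟩ ⟨c, hc.1⟩
      omega
    · exact one_pos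
  · intro a ha
    rw [Finset.sum_range, ← hWg ⟨a, ha⟩, eq_sum_single (θ j)]
    refine Finset.sum_congr rfl fun c _ => ?_
    have := hW1 ⟨a, ha⟩ c
    simp only [c.2, ha, and_self, dif_pos, Fin.eta]
    rw [← natCast_zsmul, Int.toNat_of_nonneg (by omega)]
  · intro x hx c hc
    rw [Finset.sum_range] at hx ⊢
    rw [← hker (fun a => x a) hx ⟨c, hc⟩]
    refine Finset.sum_congr rfl fun a _ => ?_
    have := hW1 a ⟨c, hc⟩
    simp only [hc, a.2, and_self, dif_pos, Fin.eta]
    rw [Int.toNat_of_nonneg (by omega)]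
  · refine ⟨fun c => if hc : c < d j then vq' ⟨c, hc⟩ else 0, fun c => ?_, ?_⟩
    · dsimp only
      split_ifs with hc
      · exact h.le_transition _ le_rfl hvq _
      · exact le_rfl
    · rw [Finset.sum_range, ← hvqg, ← h.map_transition ((le_max_left _ _).trans hj),
        eq_sum_single (θ j)]
      refine Finset.sum_congr rfl fun c _ => ?_
      simp only [c.2, dif_pos, Fin.eta, vq']

end Presents

end DimGroup

/-! ### Towers for a non-cyclic simple dimension group -/

namespace DimGroup

theorem sum_range_two_mul {M : Type*} [AddCommMonoid M] (f : ℕ → M) (m : ℕ) :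
    ∑ e ∈ Finset.range (2 * m), f e = ∑ c ∈ Finset.range m, (f (2 * c) + f (2 * c + 1)) := by
  induction m with
  | zero => simp
  | succ m ih =>
    rw [mul_add, mul_one, Finset.sum_range_succ, Finset.sum_range_succ, ih,
      Finset.sum_range_succ, add_assoc]

/-- The numbers `(K ^ (c + 1) + ε) * β c`, `ε ∈ {0, 1}`, are distinct if `K` is large. -/
theorem pow_add_mod_mul_injective {K m : ℕ} {β : ℕ → ℕ} (hβ : ∀ c, 0 < β c)
    (hK : ∀ c < m, 2 * β c < K) {e e' : ℕ} (he : e < 2 * m) (he' : e' < 2 * m)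
    (h : (K ^ (e / 2 + 1) + e % 2) * β (e / 2) = (K ^ (e' / 2 + 1) + e' % 2) * β (e' / 2)) :
    e = e' := by
  have key : ∀ e e' : ℕ, e < 2 * m → e / 2 < e' / 2 →
      (K ^ (e / 2 + 1) + e % 2) * β (e / 2) < (K ^ (e' / 2 + 1) + e' % 2) * β (e' / 2) := by
    intro e e' he hlt
    have hK0 := hK (e / 2) (by omega)
    have hK1 : 0 < K ^ (e / 2 + 1) := Nat.pow_pos (by omega)
    have h2 : e % 2 ≤ K ^ (e / 2 + 1) := by omega
    calc (K ^ (e / 2 + 1) + e % 2) * β (e / 2)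
        ≤ (K ^ (e / 2 + 1) + K ^ (e / 2 + 1)) * β (e / 2) :=
          Nat.mul_le_mul_right _ (Nat.add_le_add_left h2 _)
      _ = K ^ (e / 2 + 1) * (2 * β (e / 2)) := by ring
      _ < K ^ (e / 2 + 1) * K := Nat.mul_lt_mul_of_pos_left hK0 hK1
      _ = K ^ (e / 2 + 1 + 1) := (pow_succ _ _).symm
      _ ≤ K ^ (e' / 2 + 1) := Nat.pow_le_pow_right (by omega) (by omega)
      _ ≤ K ^ (e' / 2 + 1) + e' % 2 := Nat.le_add_right _ _
      _ ≤ _ := Nat.le_mul_of_pos_right _ (hβ _)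
  rcases lt_trichotomy (e / 2) (e' / 2) with hlt | heq | hlt
  · exact absurd h (key e e' he hlt).ne
  · rw [heq] at h
    have := Nat.eq_of_mul_eq_mul_right (hβ _) h
    omega
  · exact absurd h (key e' e he' hlt).ne'

variable {d : ℕ → ℕ} {A : ∀ i, Matrix (Fin (d (i + 1))) (Fin (d i)) ℤ}
  {G : Type*} [AddCommGroup G] {Gp : Set G} {θ : ∀ i, (Fin (d i) → ℤ) →+ G}

/-- One level of towers, with the classes `γ a` of their bottom floors and their heights. -/
structure Stage (Gp : Set G) where
  k : ℕ
  γ : ℕ → G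
  h : ℕ → ℕ
  two_le : 2 ≤ k
  pos : ∀ a < k, γ a ∈ Gp ∧ γ a ≠ 0

/-- The towers of `s'` are stacked from those of `s` according to `M`. -/
structure Stage.Refines (s : Stage Gp) (q : G) (Φ : ℕ → ℕ) (s' : Stage Gp) (M : ℕ → ℕ → ℕ) :
    Prop where
  M_pos : ∀ b a, 0 < M b a
  h_eq : ∀ b, s'.h b = ∑ a ∈ Finset.range s.k, M b a * s.h a
  γ_eq : ∀ a < s.k, s.γ a = ∑ b ∈ Finset.range s'.k, M b a • s'.γ b
  ker : ∀ x : ℕ → ℤ, ∑ a ∈ Finset.range s.k, x a • s.γ a = 0 →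
    ∀ b < s'.k, ∑ a ∈ Finset.range s.k, (M b a : ℤ) * x a = 0
  row_inj : ∀ b b', b < s'.k → b' < s'.k → (∀ a < s.k, M b a = M b' a) → b = b'
  le : ∀ b a, Φ s'.k ≤ M b a
  exhaust : ∃ y : ℕ → ℤ, (∀ b, 0 ≤ y b) ∧ q = ∑ b ∈ Finset.range s'.k, y b • s'.γ b

theorem Presents.exists_refines (h : Presents A Gp θ) (hA : Presents.Growing A) (s : Stage Gp)
    {q : G} (hq : q ∈ Gp) (Φ : ℕ → ℕ) : ∃ s' M, s.Refines q Φ s' M := by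
  obtain ⟨m, g', M, hm, hg', hM, hgM, hker, y, hy, hqy⟩ := h.exists_refinement s.pos hq
  let K := Φ (2 * m) + 2 * (∑ c ∈ Finset.range m, M c 0) + 1
  have hKβ : ∀ c < m, 2 * M c 0 < K := by
    intro c hc
    have := Finset.single_le_sum (f := fun c => M c 0) (fun _ _ => Nat.zero_le _)
      (Finset.mem_range.2 hc)
    omega
  have hK1 : ∀ c, K ≤ K ^ (c + 1) := fun c => by
    rw [pow_succ]
    exact Nat.le_mul_of_pos_left _ (Nat.pow_pos (by omega))
  have hsplit : ∀ c, ∃ γ : ℕ → G, c < m → (∀ ε, γ ε ∈ Gp ∧ γ ε ≠ 0) ∧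
      g' c = K ^ (c + 1) • γ 0 + (K ^ (c + 1) + 1) • γ 1 := by
    intro c
    by_cases hc : c < m
    · obtain ⟨γ₀, γ₁, h0, h1, h2⟩ := h.exists_split hA (hg' c hc).1 (hg' c hc).2
        (p := K ^ (c + 1)) (q := K ^ (c + 1) + 1) (by simp)
      refine ⟨fun ε => if ε = 0 then γ₀ else γ₁, fun _ => ⟨fun ε => ?_, by simpa using h2⟩⟩
      dsimp only
      split_ifs
      · exact h0
      · exact h1
    · exact ⟨0, fun h => absurd h hc⟩
  choose γ hγ using hsplit
  let N : ℕ → ℕ := fun e => K ^ (e / 2 + 1) + e % 2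
  have hKN : ∀ e, K ≤ N e := fun e => (hK1 _).trans (Nat.le_add_right _ _)
  have hN0 : ∀ c, N (2 * c) = K ^ (c + 1) := fun c => by
    have h1 : 2 * c / 2 = c := by omega
    have h2 : 2 * c % 2 = 0 := by omega
    simp only [N, h1, h2, add_zero]
  have hN1 : ∀ c, N (2 * c + 1) = K ^ (c + 1) + 1 := fun c => by
    have h1 : (2 * c + 1) / 2 = c := by omega
    have h2 : (2 * c + 1) % 2 = 1 := by omega
    simp only [N, h1, h2]
  have hsum : ∀ z : ℕ → ℤ, ∑ c ∈ Finset.range m, z c • g' c =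
      ∑ e ∈ Finset.range (2 * m), (N e * z (e / 2)) • γ (e / 2) (e % 2) := by
    intro z
    rw [sum_range_two_mul]
    refine Finset.sum_congr rfl fun c hc => ?_
    have h1 : 2 * c / 2 = c := by omega
    have h2 : 2 * c % 2 = 0 := by omega
    have h3 : (2 * c + 1) / 2 = c := by omega
    have h4 : (2 * c + 1) % 2 = 1 := by omega
    rw [hN0, hN1, h1, h2, h3, h4, (hγ c (Finset.mem_range.1 hc)).2, smul_add, mul_comm, mul_smul,
      mul_comm, mul_smul, natCast_zsmul, natCast_zsmul]
  let s' : Stage Gp :=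
    { k := 2 * m
      γ := fun e => γ (e / 2) (e % 2)
      h := fun b => ∑ a ∈ Finset.range s.k, N b * M (b / 2) a * s.h a
      two_le := by omega
      pos := fun e he => (hγ (e / 2) (by omega)).1 _ }
  refine ⟨s', fun b a => N b * M (b / 2) a, ?_, fun b => rfl, ?_, ?_, ?_, ?_, ?_⟩
  · exact fun b a => Nat.mul_pos (by have := hKN b; omega) (hM _ _)
  · intro a ha
    have := hsum fun c => M c a
    simp only [natCast_zsmul, ← Nat.cast_mul] at this
    rw [hgM a ha, this]
  · intro x hx b hb
    have := hker x hx (b / 2) (by change b < 2 * m at hb; omega)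
    simp only [Nat.cast_mul, mul_assoc, ← Finset.mul_sum, this, mul_zero]
  · intro b b' hb hb' hbb
    exact pow_add_mod_mul_injective (fun c => hM c 0) hKβ hb hb'
      (hbb 0 (lt_of_lt_of_le two_pos s.two_le))
  · intro b a
    have h1 := hKN b
    have h2 : N b ≤ N b * M (b / 2) a := Nat.le_mul_of_pos_right _ (hM _ _)
    change Φ (2 * m) ≤ N b * M (b / 2) a
    omega
  · exact ⟨fun e => N e * y (e / 2), fun e => mul_nonneg (by positivity) (hy _), hqy.trans (hsum y)⟩

/-- A non-cyclic simple dimension group is the limit of the groups of integer vectors along the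
incidence matrices of a recognizable sequence of towers, with entries as large as one likes. -/
theorem Presents.exists_towerData (h : Presents A Gp θ) (hA : Presents.Growing A)
    (hG : IsOrderedGroup Gp) {u : G} (hu : u ∈ Gp) (hu0 : u ≠ 0)
    (Φ : ℕ → ℕ → (ℕ → ℕ) → ℕ → ℕ) :
    ∃ (B : TowerData) (γ : ℕ → ℕ → G), B.Recognizable ∧ B.Compatible γ ∧
      (∀ n a, a < B.d n → γ n a ∈ Gp) ∧
      (∀ n x, B.eval γ n x = 0 → ∀ b < B.d (n + 1), B.push n x b = 0) ∧
      (∀ g ∈ Gp, ∃ n x, (∀ a, 0 ≤ x a) ∧ B.eval γ n x = g) ∧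
      u = ∑ a ∈ Finset.range (B.d 0), B.h 0 a • γ 0 a ∧
      ∀ n b a, Φ n (B.d n) (B.h n) (B.d (n + 1)) ≤ B.A n b a := by
  have := hG.countable
  have : Nonempty Gp := ⟨⟨u, hu⟩⟩
  obtain ⟨q, hq⟩ := exists_surjective_nat Gp
  obtain ⟨γ₀, γ₁, h0, h1, hu'⟩ := h.exists_split hA hu hu0 (p := 1) (q := 1) (by simp)
  let s₀ : Stage Gp :=
    { k := 2
      γ := fun a => if a = 0 then γ₀ else γ₁
      h := fun _ => 1
      two_le := le_rfl
      pos := fun a _ => by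
        split_ifs
        · exact h0
        · exact h1 }
  choose next M hM using fun (n : ℕ) (s : Stage Gp) =>
    h.exists_refines hA s (q n).2 (Φ n s.k s.h)
  let s : ℕ → Stage Gp := fun n => Nat.rec s₀ (fun n s => next n s) n
  have hs : ∀ n, (s n).Refines (q n).1 (Φ n (s n).k (s n).h) (s (n + 1)) (M n (s n)) :=
    fun n => hM n (s n)
  refine ⟨⟨fun n => (s n).k, fun n => M n (s n), fun n => (s n).h,
    fun n => lt_of_lt_of_le two_pos (s n).two_le, fun n => (hs n).M_pos, fun _ => one_pos,
    fun n => (hs n).h_eq⟩, fun n => (s n).γ, ⟨fun n => (s n).two_le, rfl, fun _ => rfl,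
    fun n => (hs n).row_inj⟩, fun n => (hs n).γ_eq, fun n a ha => ((s n).pos a ha).1,
    fun n => (hs n).ker, fun g hg => ?_, ?_, fun n => (hs n).le⟩
  · obtain ⟨n, hn⟩ := hq ⟨g, hg⟩
    obtain ⟨y, hy, hqy⟩ := (hs n).exhaust
    rw [hn] at hqy
    exact ⟨n + 1, y, hy, hqy.symm⟩
  · change u = ∑ a ∈ Finset.range 2, 1 • (if a = 0 then γ₀ else γ₁)
    rw [hu']
    simp [Finset.sum_range_succ]

end DimGroup

/-! ### The cyclic case -/

namespace DimGroup

namespace Presents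

variable {d : ℕ → ℕ} {A : ∀ i, Matrix (Fin (d (i + 1))) (Fin (d i)) ℤ}
  {G : Type*} [AddCommGroup G] {Gp : Set G} {θ : ∀ i, (Fin (d i) → ℤ) →+ G}

/-- If the presentation is eventually constant, then the group is `ℤ` with the usual order. -/
theorem exists_generator (h : Presents A Gp θ) (hA : ¬ Growing A) :
    ∃ e ∈ Gp, (∀ g ∈ Gp, ∃ n : ℕ, g = n • e) ∧ ∀ c : ℤ, c • e = 0 → c = 0 := by
  simp only [Growing, not_forall, not_exists, not_and, not_not] at hA
  obtain ⟨i₀, hi₀⟩ := hA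
  have hone : ∀ i ≥ i₀, θ i (fun _ => 1) = θ i₀ (fun _ => 1) := by
    intro i hi
    induction i, hi using Nat.le_induction with
    | base => rfl
    | succ i hi ih =>
      rw [← ih, ← h.map_mulVec i]
      congr 1
      funext b
      obtain ⟨h1, h2⟩ := hi₀ i hi
      simp [Matrix.mulVec, dotProduct, h2, h1]
  have hnn : ∀ j : Fin (d i₀), (0 : ℤ) ≤ 1 := fun _ => zero_le_one
  refine ⟨θ i₀ fun _ => 1, h.mem_of_nonneg hnn, fun g hg => ?_, fun c hc => ?_⟩
  · obtain ⟨i, x, hx, rfl⟩ := (h.mem_iff g).1 hg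
    have hd := (hi₀ (max i i₀) (le_max_right _ _)).1
    let y := transition d A i (max i i₀) (le_max_left _ _) x
    have hy : ∀ c, 0 ≤ y c := h.le_transition _ le_rfl hx
    obtain ⟨n, hn⟩ := Int.eq_ofNat_of_zero_le (hy ⟨0, by omega⟩)
    refine ⟨n, ?_⟩
    rw [← hone _ (le_max_right i i₀), ← map_nsmul, ← h.map_transition (le_max_left i i₀)]
    congr 1
    funext b
    obtain rfl : b = ⟨0, by omega⟩ := Fin.ext (by have := b.2; simp only; omega)
    simpa using hn
  · by_contra hne
    have h1 : c.natAbs • θ i₀ (fun _ => 1) = 0 := by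
      rcases Int.natAbs_eq c with h | h
      · rw [h, natCast_zsmul] at hc; exact hc
      · rw [h, neg_smul, natCast_zsmul, neg_eq_zero] at hc; exact hc
    rw [← map_nsmul] at h1
    refine h.ne_zero (x := c.natAbs • fun _ => 1) (fun b => by simp) (fun h0 => ?_) h1
    have := congrFun h0 ⟨0, h.d_pos i₀⟩
    simp at this
    exact hne this

end Presents

/-- The periodic subshift of all sequences `i ↦ c + i` over `Fin (m + 1)`. -/
def cyclicSubshift (m : ℕ) : Subshift (Fin (m + 1)) ℤ where
  carrier := {y | ∀ i, y (i + 1) = y i + 1}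
  isClosed := by
    have : {y : ℤ → Fin (m + 1) | ∀ i, y (i + 1) = y i + 1} =
        ⋂ i, {y | y (i + 1) = y i + 1} := by
      ext y; simp
    rw [this]
    refine isClosed_iInter fun i => ?_
    exact (isClosed_discrete {p : Fin (m + 1) × Fin (m + 1) | p.1 = p.2 + 1}).preimage
      (f := fun y : ℤ → Fin (m + 1) => (y (i + 1), y i)) (by fun_prop)
  mapsTo := by
    intro g y hy i
    have := hy (g + i)
    rwa [add_assoc] at this

theorem cyclicSubshift_add {m : ℕ} {y : ℤ → Fin (m + 1)} (hy : y ∈ (cyclicSubshift m).carrier)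
    (i : ℤ) (k : ℕ) : y (i + k) = y i + Fin.ofNat (m + 1) k := by
  induction k with
  | zero => simp
  | succ k ih =>
    have h1 := hy (i + k)
    rw [ih] at h1
    push_cast
    rw [← add_assoc, h1, add_assoc]
    congr 1
    ext
    simp [Fin.val_add]

theorem cyclicSubshift_ext {m : ℕ} {y y' : (cyclicSubshift m).carrier} (h : y.1 0 = y'.1 0) :
    y = y' := by
  refine Subtype.ext (funext fun i => ?_)
  rcases Int.natAbs_eq i with hi | hi
  · have h1 := cyclicSubshift_add y.2 0 i.natAbs
    have h2 := cyclicSubshift_add y'.2 0 i.natAbs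
    rw [zero_add, ← hi] at h1 h2
    rw [h1, h2, h]
  · have h1 := cyclicSubshift_add y.2 i i.natAbs
    have h2 := cyclicSubshift_add y'.2 i i.natAbs
    rw [show i + (i.natAbs : ℤ) = 0 by omega] at h1 h2
    rw [h1, h2] at h
    exact add_right_cancel h

instance (m : ℕ) : CompactSpace (cyclicSubshift m).carrier :=
  isCompact_iff_compactSpace.1 (cyclicSubshift m).isClosed.isCompact

instance (m : ℕ) : Nonempty (cyclicSubshift m).carrier :=
  ⟨⟨fun i => ((i : ZMod (m + 1)) : ZMod (m + 1)), fun i => by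
    change ((i + 1 : ℤ) : ZMod (m + 1)) = (i : ZMod (m + 1)) + 1
    push_cast
    rfl⟩⟩

theorem complexity_cyclicSubshift_le (m n : ℕ) : complexity (cyclicSubshift m) n ≤ m + 1 := by
  have hsub : language (cyclicSubshift m) n ⊆
      (fun (c : Fin (m + 1)) (k : Fin n) => c + Fin.ofNat (m + 1) (k : ℕ)) '' Set.univ := by
    rintro w ⟨y, hy, i, hw⟩
    exact ⟨y i, trivial, funext fun k => by rw [hw, cyclicSubshift_add hy]⟩
  refine (Set.ncard_le_ncard hsub (Set.toFinite _)).trans ((Set.ncard_image_le).trans ?_)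
  simp

/-- A single tower of height `m + 1` at every level. -/
def cyclicTowerData (m : ℕ) : TowerData where
  d _ := 1
  A _ _ _ := 1
  h _ _ := m + 1
  d_pos _ := one_pos
  A_pos _ _ _ := one_pos
  h_zero_pos _ := Nat.succ_pos m
  h_succ _ _ := by simp

/-- The periodic subshift as a system with nested tower partitions. -/
def cyclicTowerSystem (m : ℕ) : TowerSystem (cyclicTowerData m) (shiftMap (cyclicSubshift m)) where
  addr _ y := (0, y.1 0)
  continuous_addr _ := (continuous_of_discreteTopology
      (f := fun c : Fin (m + 1) => ((0 : ℕ), (c : ℕ)))).comp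
    ((continuous_apply 0).comp continuous_subtype_val)
  valid _ y := ⟨one_pos, (y.1 0).2⟩
  step _ y := by
    have h1 : (shiftMap (cyclicSubshift m) y).1 0 = y.1 0 + 1 := by
      rw [← y.2 0]
      rfl
    rw [h1]
    have h2 := Fin.val_add_one (y.1 0)
    constructor
    · intro h3
      change (y.1 0 : ℕ) + 1 < m + 1 at h3
      rw [if_neg (fun h4 => by rw [h4, Fin.val_last] at h3; omega)] at h2
      rw [h2]
    · intro h3
      change (y.1 0 : ℕ) + 1 = m + 1 at h3
      rw [if_pos (Fin.ext (by rw [Fin.val_last]; omega))] at h2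
      exact h2
  loc_addr n y := by
    have := TowerData.loc_pos_add (B := cyclicTowerData m) (n := n) (b := 0) (a := 0)
      (s := (y.1 0 : ℕ)) one_pos (by
        change _ < 1 * (m + 1)
        rw [one_mul]
        exact (y.1 0).2)
    rw [TowerData.pos_zero, zero_add] at this
    rw [this]
    congr 1
    exact Nat.mod_eq_of_lt (y.1 0).2
  separates f := ⟨0, fun _ _ y y' h => by
    refine congrArg f (cyclicSubshift_ext (Fin.ext ?_))
    rcases h with h | ⟨h, hy⟩
    · exact congrArg Prod.snd h
    · exact h.trans hy.symm⟩

/-! ### Realization with low complexity -/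

theorem eventually_mul_le {p : ℕ → ℝ} (hp : ∀ n, 0 < p n)
    (hlim : Tendsto (fun n : ℕ => (n : ℝ) / p n) atTop (𝓝 0)) (C : ℕ) :
    ∃ T : ℕ, ∀ m ≥ T, (C : ℝ) * m ≤ p m := by
  have hC : (0 : ℝ) < 1 / (C + 1) := by positivity
  obtain ⟨T, hT⟩ := eventually_atTop.1 (hlim.eventually (gt_mem_nhds hC))
  refine ⟨T, fun m hm => ?_⟩
  have h1 := hT m hm
  rw [div_lt_div_iff₀ (hp m) (by positivity)] at h1
  nlinarith [Nat.cast_nonneg (α := ℝ) m]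

theorem exists_subshift_of_generator {G : Type*} [AddCommGroup G] {Gp : Set G}
    (hG : IsOrderedGroup Gp) {e : G} (he : e ∈ Gp) (hgen : ∀ g ∈ Gp, ∃ n : ℕ, g = n • e)
    (htf : ∀ c : ℤ, c • e = 0 → c = 0) (m : ℕ) :
    IsMinimalSystem (shiftMap (cyclicSubshift m)) ∧
      OrderedUnitIso (K0.pos (shiftMap (cyclicSubshift m))) (K0.unit (shiftMap (cyclicSubshift m)))
        Gp ((m + 1) • e) := by
  refine ⟨(cyclicTowerSystem m).isMinimalSystem,
    (cyclicTowerSystem m).orderedUnitIso (γ := fun _ _ => e) hG ?_ (fun _ _ _ => he) ?_ ?_ ?_⟩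
  · intro n a _
    change e = ∑ b ∈ Finset.range 1, 1 • e
    simp
  · intro n x hx b _
    change ∑ a ∈ Finset.range 1, x a • e = 0 at hx
    change ∑ a ∈ Finset.range 1, ((1 : ℕ) : ℤ) * x a = 0
    rw [Finset.sum_range_one] at hx ⊢
    rw [htf _ hx, mul_zero]
  · intro g hg
    obtain ⟨n, rfl⟩ := hgen g hg
    refine ⟨0, fun _ => n, fun _ => by positivity, ?_⟩
    change ∑ a ∈ Finset.range 1, (n : ℤ) • e = n • e
    simp
  · change (m + 1) • e = ∑ a ∈ Finset.range 1, (m + 1) • e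
    simp

theorem tendsto_complexity_of_bounded {p : ℕ → ℝ} (hp : ∀ n, 0 < p n)
    (hlim : Tendsto (fun n : ℕ => (n : ℝ) / p n) atTop (𝓝 0)) {c : ℕ → ℕ} {m : ℕ}
    (hc : ∀ n, c n ≤ m) : Tendsto (fun n : ℕ => (c n : ℝ) / p n) atTop (𝓝 0) := by
  have h1 : Tendsto (fun n : ℕ => (m : ℝ) * ((n : ℝ) / p n)) atTop (𝓝 0) := by
    simpa using hlim.const_mul (m : ℝ)
  refine squeeze_zero' (Eventually.of_forall fun n => by have := hp n; positivity) ?_ h1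
  filter_upwards [eventually_ge_atTop 1] with n hn
  rw [← mul_div_assoc]
  refine div_le_div_of_nonneg_right ?_ (hp n).le
  have h2 : c n ≤ m * n := (hc n).trans (Nat.le_mul_of_pos_right m hn)
  exact_mod_cast h2

/-- Entries of the incidence matrices above these thresholds force low complexity. -/
theorem tendsto_complexity {B : TowerData} {p : ℕ → ℝ} (hp : ∀ n, 0 < p n) {T : ℕ → ℕ}
    (hT : ∀ C : ℕ, ∀ m ≥ T C, (C : ℝ) * m ≤ p m)
    (hB : ∀ n b a, B.d n * (∑ a ∈ Finset.range (B.d n), B.h n a) + n +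
      T ((n + 1) * (1 + B.d (n + 1) * B.d n + B.d (n + 1))) ≤ B.A n b a) :
    Tendsto (fun n : ℕ => (complexity B.subshift n : ℝ) / p n) atTop (𝓝 0) := by
  let N : ℕ → ℕ := fun n => B.d n * (∑ a ∈ Finset.range (B.d n), B.h n a) + n +
    T ((n + 1) * (1 + B.d (n + 1) * B.d n + B.d (n + 1)))
  have hN : ∀ m, ∃ n, m ≤ N n := fun m => ⟨m, by simp only [N]; omega⟩
  rw [Metric.tendsto_atTop]
  intro ε hε
  obtain ⟨n₀, hn₀⟩ := exists_nat_one_div_lt hε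
  refine ⟨(∑ j ∈ Finset.range (n₀ + 1), N j) + 1, fun m hm => ?_⟩
  have hlt : n₀ < Nat.find (hN m) := by
    by_contra! hle
    have h1 := Nat.find_spec (hN m)
    have h2 := Finset.single_le_sum (f := N) (fun _ _ => Nat.zero_le _)
      (Finset.mem_range.2 (by omega : Nat.find (hN m) < n₀ + 1))
    omega
  obtain ⟨n, hn⟩ : ∃ n, Nat.find (hN m) = n + 1 := ⟨Nat.find (hN m) - 1, by omega⟩
  have h1 : m ≤ N (n + 1) := hn ▸ Nat.find_spec (hN m)
  have h2 : N n < m := not_le.1 (Nat.find_min (hN m) (by omega))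
  have h3 := TowerData.complexity_le (B := B) (n := n) (m := m)
    fun b a _ _ => h1.trans (hB (n + 1) b a)
  set C := 1 + B.d (n + 1) * B.d n + B.d (n + 1) with hC
  have h4 : complexity B.subshift m ≤ C * m := by
    have : C * m = m + (B.d (n + 1) * (B.d n * m) + B.d (n + 1) * m) := by rw [hC]; ring
    simp only [N] at h2
    omega
  have h5 := hT ((n + 1) * C) m (by simp only [N, ← hC] at h2; omega)
  have h6 : (complexity B.subshift m : ℝ) ≤ C * m := by exact_mod_cast h4
  have hpm := hp m
  rw [Real.dist_eq, sub_zero, abs_of_nonneg (by positivity)]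
  refine lt_of_le_of_lt ?_ hn₀
  rw [div_le_div_iff₀ hpm (by positivity), one_mul]
  have h7 : (n₀ : ℝ) + 1 ≤ n + 1 := by
    have : n₀ + 1 ≤ n + 1 := by omega
    exact_mod_cast this
  calc (complexity B.subshift m : ℝ) * (n₀ + 1) ≤ C * m * (n + 1) :=
        mul_le_mul h6 h7 (by positivity) (by positivity)
    _ = ((n + 1) * C : ℕ) * (m : ℝ) := by push_cast; ring
    _ ≤ p m := h5

end DimGroup

theorem theorem1 {G : Type*} [AddCommGroup G] (Gp : Set G) (u : G)
    (hG : DimGroup.IsSimpleDimensionGroup Gp) (hu : DimGroup.IsOrderUnit Gp u)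
    (p : ℕ → ℝ) (hp : ∀ n, 0 < p n)
    (hlim : Tendsto (fun n : ℕ => (n : ℝ) / p n) atTop (𝓝 0)) :
    ∃ (𝒜 : Type) (_ : Fintype 𝒜) (_ : TopologicalSpace 𝒜) (_ : DiscreteTopology 𝒜)
      (Y : Subshift 𝒜 ℤ),
      DimGroup.IsMinimalSystem (DimGroup.shiftMap Y) ∧
      DimGroup.OrderedUnitIso
        (DimGroup.K0.pos (DimGroup.shiftMap Y)) (DimGroup.K0.unit (DimGroup.shiftMap Y)) Gp u ∧
      Tendsto (fun n : ℕ => (DimGroup.complexity Y n : ℝ) / p n) atTop (𝓝 0) := by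
  obtain ⟨⟨hO, -⟩, d, A, hd, hA, hiso⟩ := hG
  obtain ⟨θ, hθ⟩ := DimGroup.exists_presents hd hA hiso
  have hu0 : u ≠ 0 := by
    rintro rfl
    obtain ⟨hg, hg0⟩ := hθ.pos_of_one_le (i := 0) (x := fun _ => 1) fun _ => le_rfl
    obtain ⟨k, hk⟩ := hu.2 (θ 0 fun _ => 1)
    rw [smul_zero, zero_sub] at hk
    exact hg0 ((hO.mem_and_neg_mem _).1 ⟨hg, hk⟩)
  by_cases hgrow : DimGroup.Presents.Growing A
  · choose T hT using DimGroup.eventually_mul_le hp hlim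
    obtain ⟨B, γ, hB, hγ, hpos, hker, hex, hunit, hΦ⟩ := hθ.exists_towerData hgrow hO hu.1 hu0
      fun n k h k' => k * (∑ a ∈ Finset.range k, h a) + n + T ((n + 1) * (1 + k' * k + k'))
    exact ⟨Bool, inferInstance, inferInstance, inferInstance, B.subshift,
      hB.towerSystem.isMinimalSystem,
      hB.towerSystem.orderedUnitIso hO hγ hpos hker hex hunit,
      DimGroup.tendsto_complexity hp hT hΦ⟩
  · obtain ⟨e, he, hgen, htf⟩ := hθ.exists_generator hgrow
    obtain ⟨k, rfl⟩ := hgen u hu.1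
    obtain ⟨m, rfl⟩ := Nat.exists_eq_succ_of_ne_zero (n := k) fun h => hu0 (by rw [h, zero_smul])
    obtain ⟨h1, h2⟩ := DimGroup.exists_subshift_of_generator hO he hgen htf m
    exact ⟨Fin (m + 1), inferInstance, inferInstance, inferInstance, DimGroup.cyclicSubshift m,
      h1, h2, DimGroup.tendsto_complexity_of_bounded hp hlim
        fun n => DimGroup.complexity_cyclicSubshift_le m n⟩
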